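/- Let $B_3=\langle \sigma_1,\sigma_2 \mid \sigma_1\sigma_2\sigma_1=\sigma_2\sigma_1\sigma_2\rangle$ be the 3-strand braid group, and let $B_t\colon B_3\to \mathrm{GL}_2(\mathbb Z[t^{\pm1}])$ be the reduced Burau representation, $$B_t(\sigma_1)=\begin{pmatrix}-t&1\\0&1\end{pmatrix},\qquad B_t(\sigma_2)=\begin{pmatrix}1&0\\t&-t\end{pmatrix}.$$ A braid is positive if it is a product of $\sigma_1$'s and $\sigma_2$'s (without inverses); for such $w$ the entries of $B_t(w)$ are polynomials in $t$, and for $t\in\mathbb C$ let $\rho_w(t)$ be the spectral radius of the complex matrix $B_t(w)$, that is, the largest absolute value of an eigenvalue. A braid $w\in B_3$ is called pseudo-Anosov if the mapping class it induces on the four-punctured sphere (the 3-punctured disc with its boundary capped off by a once-punctured disc) is pseudo-Anosov in the Nielsen--Thurston classification, i.e. neither periodic nor reducible. **Theorem.** Let $w\in B_3$ be a positive pseudo-Anosov braid whose closure $\hat w$ is a knot. Then: 1. The equation $\rho_w(t)=1$ has exactly two solutions $t\in[-1,1]$: the point $t=1$, and a point $t_0\in\left(-1,\frac{\sqrt5-3}{2}\right]$.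 In particular, $t_0$ is the unique $t\in[-1,1)$ with $\rho_w(t)=1$. 2. The function $t\mapsto\rho_w(t)$ is strictly decreasing on $[-1,0]$. 3. The function $t\mapsto\rho_w(t)$ of the real variable $t$ is real analytic on $[-1,0)$, i.e. in a neighbourhood of each point of $[-1,0)$. -/

import Mathlib

noncomputable section

namespace ThreeBraid

open LaurentPolynomial

/-! ### The braid group on three strands -/

/-- The braid relation `σ₁ σ₂ σ₁ = σ₂ σ₁ σ₂`; the generator with index `0` is `σ₁` and the one
with index `1` is `σ₂`. -/
def braidRels : Set (FreeGroup (Fin 2)) :=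
  {FreeGroup.of 0 * FreeGroup.of 1 * FreeGroup.of 0 *
    (FreeGroup.of 1 * FreeGroup.of 0 * FreeGroup.of 1)⁻¹}

/-- The braid group on three strands. -/
abbrev Braid3 : Type := PresentedGroup braidRels

/-- The standard generators: `σ 0` is `σ₁` and `σ 1` is `σ₂`. -/
def σ (i : Fin 2) : Braid3 := PresentedGroup.of i

/-- A braid is positive if it is a product of the generators `σ₁`, `σ₂` (without inverses). -/
def IsPositive (w : Braid3) : Prop := w ∈ Submonoid.closure (Set.range σ)

/-! ### The reduced Burau representation -/

theorem T_one_mul_T_neg_one : (T 1 : ℤ[T;T⁻¹]) * T (-1) = 1 := by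
  rw [← T_add, add_neg_cancel, T_zero]

theorem T_neg_one_mul_T_one : (T (-1) : ℤ[T;T⁻¹]) * T 1 = 1 := by
  rw [← T_add, neg_add_cancel, T_zero]

/-- The Burau matrices `B_t(σ₁)` and `B_t(σ₂)`, with their inverses. -/
def burauGen : Fin 2 → GL (Fin 2) ℤ[T;T⁻¹] :=
  ![{ val := !![-T 1, 1; 0, 1]
      inv := !![-T (-1), T (-1); 0, 1]
      val_inv := by
        simp only [Matrix.mul_fin_two, Matrix.one_fin_two, neg_mul, mul_neg, neg_neg, mul_zero,
          zero_mul, mul_one, add_zero, zero_add, neg_zero, neg_add_cancel, T_one_mul_T_neg_one]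
      inv_val := by
        simp only [Matrix.mul_fin_two, Matrix.one_fin_two, neg_mul, mul_neg, neg_neg, mul_zero,
          zero_mul, mul_one, add_zero, zero_add, neg_zero, neg_add_cancel, T_neg_one_mul_T_one] },
    { val := !![1, 0; T 1, -T 1]
      inv := !![1, 0; 1, -T (-1)]
      val_inv := by
        simp only [Matrix.mul_fin_two, Matrix.one_fin_two, neg_mul, mul_neg, neg_neg, mul_zero,
          zero_mul, mul_one, add_zero, zero_add, neg_zero, add_neg_cancel, T_one_mul_T_neg_one]
      inv_val := by
        simp only [Matrix.mul_fin_two, Matrix.one_fin_two, neg_mul, mul_neg, neg_neg, mul_zero,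
          zero_mul, mul_one, add_zero, zero_add, neg_zero, add_neg_cancel, T_neg_one_mul_T_one] }]

theorem burauGen_rel : ∀ r ∈ braidRels, FreeGroup.lift burauGen r = 1 := by
  intro r hr
  rw [braidRels, Set.mem_singleton_iff] at hr
  subst hr
  rw [map_mul, map_inv, mul_inv_eq_one]
  simp only [map_mul, FreeGroup.lift_apply_of]
  apply Units.ext
  simp only [Units.val_mul, burauGen, Matrix.cons_val_zero, Matrix.cons_val_one,
    Matrix.mul_fin_two]
  congr 1
  ring_nf

/-- The reduced Burau representation of the braid group on three strands. -/
def burau : Braid3 →* GL (Fin 2) ℤ[T;T⁻¹] := PresentedGroup.toGroup burauGen_rel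

/-- The value `∑ aₙ tⁿ` of the Laurent polynomial `∑ aₙ Tⁿ` at a complex number `t`. For a
polynomial (no negative exponents) this is also its value at `t = 0`, as `0 ^ 0 = 1`. -/
def evalAt (t : ℂ) (p : ℤ[T;T⁻¹]) : ℂ := p.coeff.sum fun n a => (a : ℂ) * t ^ n

/-- The complex matrix `B_t(w)`. -/
def burauAt (t : ℂ) (w : Braid3) : Matrix (Fin 2) (Fin 2) ℂ :=
  (burau w : Matrix (Fin 2) (Fin 2) ℤ[T;T⁻¹]).map (evalAt t)

/-- The spectral radius function `ρ_w(t)`: the largest absolute value of an eigenvalue of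
`B_t(w)`. -/
def rho (w : Braid3) (t : ℂ) : ℝ := (spectralRadius ℂ (burauAt t w)).toReal

/-! ### The closure of a braid -/

/-- The transpositions of the strands given by the generators. -/
def permGen : Fin 2 → Equiv.Perm (Fin 3) := ![Equiv.swap 0 1, Equiv.swap 1 2]

theorem permGen_rel : ∀ r ∈ braidRels, FreeGroup.lift permGen r = 1 := by
  intro r hr
  rw [braidRels, Set.mem_singleton_iff] at hr
  subst hr
  simp only [map_mul, map_inv, FreeGroup.lift_apply_of]
  decide

/-- The permutation of the three endpoints that is induced by a braid. -/
def strandPerm : Braid3 →* Equiv.Perm (Fin 3) := PresentedGroup.toGroup permGen_rel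

/-- The components of the closure of `w`: the closure joins the endpoint of each strand to the
starting point of the next one, so that its components correspond to the cycles (fixed points
included) of the permutation of the strands. -/
def ClosureComponents (w : Braid3) : Type :=
  MulAction.orbitRel.Quotient (Subgroup.zpowers (strandPerm w)) (Fin 3)

/-- The closure of `w` is a knot: it has exactly one component. -/
def ClosureIsKnot (w : Braid3) : Prop := Nat.card (ClosureComponents w) = 1

/-! ### The associated mapping class of the four-punctured sphere

The sphere with four punctures is modelled as `ℂ` (the sphere punctured at `∞`) with the three
further punctures `-1, 0, 1`. Its homeomorphisms that fix `∞` are the homeomorphisms of `ℂ`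
that preserve `{-1, 0, 1}`. -/

/-- The three finite punctures. -/
def punctures : Set ℂ := {-1, 0, 1}

/-- The map that rotates the circle of radius `r` about `c` by the angle `a` for `r ≤ 1 / 2` and
by the angle `a * (2 - 2 * r)` for `1 / 2 ≤ r ≤ 1`, and that is the identity outside the disc of
radius `1` about `c`. -/
def twistFun (a : ℝ) (c z : ℂ) : ℂ :=
  c + Complex.exp ((a * max 0 (min 1 (2 - 2 * ‖z - c‖)) : ℝ) * Complex.I) * (z - c)

theorem twistFun_neg_twistFun (a : ℝ) (c z : ℂ) : twistFun (-a) c (twistFun a c z) = z := by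
  have h : ‖twistFun a c z - c‖ = ‖z - c‖ := by
    rw [twistFun, add_sub_cancel_left, norm_mul, Complex.norm_exp_ofReal_mul_I, one_mul]
  rw [twistFun, h, twistFun, add_sub_cancel_left, ← mul_assoc, ← Complex.exp_add]
  simp

theorem continuous_twistFun (a : ℝ) (c : ℂ) : Continuous (twistFun a c) := by
  unfold twistFun
  fun_prop

/-- The half twist about `c`: it rotates the disc of radius `1 / 2` about `c` by the angle `π` and
is the identity outside the disc of radius `1` about `c`. -/
def halfTwist (c : ℂ) : ℂ ≃ₜ ℂ where
  toFun := twistFun Real.pi c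
  invFun := twistFun (-Real.pi) c
  left_inv := twistFun_neg_twistFun Real.pi c
  right_inv z := by simpa using twistFun_neg_twistFun (-Real.pi) c z
  continuous_toFun := continuous_twistFun Real.pi c
  continuous_invFun := continuous_twistFun (-Real.pi) c

/-- The homeomorphism of a word in `σ₁`, `σ₂` and their inverses: `σ₁` acts as the half twist that
exchanges the punctures `-1` and `0`, and `σ₂` as the half twist that exchanges `0` and `1`. -/
def wordHomeo : FreeGroup (Fin 2) →* (ℂ ≃ₜ ℂ) :=
  FreeGroup.lift ![halfTwist (-(1 / 2)), halfTwist (1 / 2)]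

/-- `φ` and `ψ` are isotopic through homeomorphisms that preserve the set of punctures. -/
def Isotopic (φ ψ : ℂ ≃ₜ ℂ) : Prop :=
  ∃ H : unitInterval → (ℂ ≃ₜ ℂ), Continuous (fun p : unitInterval × ℂ => H p.1 p.2) ∧
    H 0 = φ ∧ H 1 = ψ ∧ ∀ s, H s '' punctures = punctures

/-- The mapping class of the four-punctured sphere associated with the braid `w`: all
homeomorphisms isotopic to the homeomorphism of a word that represents `w`. -/
def mappingClass (w : Braid3) : Set (ℂ ≃ₜ ℂ) :=
  {φ | ∃ g : FreeGroup (Fin 2), PresentedGroup.mk braidRels g = w ∧ Isotopic (wordHomeo g) φ}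

/-- A braid is periodic if its mapping class has finite order. -/
def IsPeriodic (w : Braid3) : Prop :=
  ∃ k : ℕ, 0 < k ∧ Homeomorph.refl ℂ ∈ mappingClass (w ^ k)

/-- `C` is a simple closed curve in the punctured sphere. -/
def IsSimpleClosedCurve (C : Set ℂ) : Prop :=
  (∃ γ : Circle → ℂ, Continuous γ ∧ Function.Injective γ ∧ Set.range γ = C) ∧
    Disjoint C punctures

/-- A simple closed curve in the four-punctured sphere is essential (neither null-homotopic nor
homotopic into a puncture) if there are two punctures on each of its sides: exactly two of the
punctures `-1, 0, 1` lie inside the curve, so that the third one and `∞` lie outside. -/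
def IsEssentialCurve (C : Set ℂ) : Prop :=
  IsSimpleClosedCurve C ∧
    {p ∈ punctures | Bornology.IsBounded (connectedComponentIn Cᶜ p)}.ncard = 2

/-- Isotopy of curves in the punctured sphere. -/
def IsotopicCurves (C C' : Set ℂ) : Prop :=
  ∃ ψ : ℂ ≃ₜ ℂ, Isotopic (Homeomorph.refl ℂ) ψ ∧ ψ '' C = C'

/-- A braid is reducible if its mapping class permutes, up to isotopy, the curves of a non-empty
finite system of disjoint essential simple closed curves. -/
def IsReducible (w : Braid3) : Prop :=
  ∃ S : Set (Set ℂ), S.Finite ∧ S.Nonempty ∧ (∀ C ∈ S, IsEssentialCurve C) ∧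
    S.PairwiseDisjoint id ∧
    ∃ φ ∈ mappingClass w, ∀ C ∈ S, ∃ C' ∈ S, IsotopicCurves (φ '' C) C'

/-- A braid is pseudo-Anosov if, in the Nielsen-Thurston trichotomy for its mapping class of the
four-punctured sphere, it is neither periodic nor reducible. -/
def IsPseudoAnosov (w : Braid3) : Prop := ¬ IsPeriodic w ∧ ¬ IsReducible w

end ThreeBraid

end

noncomputable section

namespace ThreeBraid

open LaurentPolynomial

/-! Let Δ = σ₁σ₂σ₁. Since Δ² is central, every positive braid is Δ^(2k) times a product of at most
2k blocks σ₁^p Δ⁻¹. Blocks with exponent 0 or 1 are absorbed by their cyclic neighbours without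
violating this bound on the length (`normalForm_of_length`). The reduction stops at a braid whose
permutation has order at most two (impossible for a knot), at a braid whose cube is a power of Δ²
(hence periodic), or at a conjugate in which all exponents are at least 2. In the last case the
permutation forces some exponent to be at least 3 (`exists_three_le`).

In a suitable basis and with s = -t, a block of exponent p ≥ 2 is, up to a scalar, the matrix with
rows (s(1 + ⋯ + s^(p-2)), s(1 + ⋯ + s^(p-3))) and (1, 1). For n blocks, B_t(w) therefore has, up to
sign, the trace and determinant of N(s) = s^(3k-n) times a product of such matrices, where n ≤ 2k.
For s > 0 the entries of N(s) are positive and strictly increasing, so ρ_w is a Perron eigenvalue: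
strictly increasing in s (`perron_lt_perron`) and analytic, because the discriminant is positive. At
s = 1 the determinant is 1 and the eigenvalue exceeds 1; at s = (3 - √5)/2 a Collatz-Wielandt vector
bounds it by 1 (`stepProd_mulVec_le`). Hence there is exactly one crossing in [-1, 0].

For 0 ≤ t < 1 a hexagonal norm that no block matrix increases gives ρ_w(t) ≤ t^(3k-n) < 1. At t = 1
the Burau matrices permute three spanning vectors, so the matrix of a 3-cycle has cube 1.

The topological input is that a braid with w³ = Δ^(2j) is periodic: the map of σ₁σ₂ is isotopic,
relative to the punctures, to a conjugate of a rotation of order three (`isotopic_twists_pow`). -/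

/-! ### Normal forms of positive braids -/

/-- The Garside element `σ₁ σ₂ σ₁`. -/
def garside : Braid3 := σ 0 * σ 1 * σ 0

/-- The braid `σ₁ᵖ Δ⁻¹`. -/
def block (p : ℕ) : Braid3 := σ 0 ^ p * garside⁻¹

/-- The product of the blocks with the given exponents. -/
def blockProd (l : List ℕ) : Braid3 := (l.map block).prod

theorem braid_rel : σ 0 * σ 1 * σ 0 = σ 1 * σ 0 * σ 1 := by
  have h := PresentedGroup.one_of_mem (rels := braidRels) (Set.mem_singleton _)
  rw [map_mul, map_inv, mul_inv_eq_one] at h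
  exact h

theorem garside_mul_sigma_zero : garside * σ 0 = σ 1 * garside := by
  unfold garside
  conv_rhs => rw [← mul_assoc, ← mul_assoc, ← braid_rel]

theorem garside_mul_sigma_one : garside * σ 1 = σ 0 * garside := by
  unfold garside
  rw [mul_assoc (σ 0 * σ 1), mul_assoc (σ 0), ← mul_assoc (σ 1), ← braid_rel]

theorem garside_sq_commute (w : Braid3) : Commute (garside ^ 2) w := by
  have h0 : Commute (garside ^ 2) (σ 0) := by
    rw [Commute, SemiconjBy, pow_two, mul_assoc, garside_mul_sigma_zero, ← mul_assoc,
      garside_mul_sigma_one, mul_assoc]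
  have h1 : Commute (garside ^ 2) (σ 1) := by
    rw [Commute, SemiconjBy, pow_two, mul_assoc, garside_mul_sigma_one, ← mul_assoc,
      garside_mul_sigma_zero, mul_assoc]
  have : w ∈ Subgroup.centralizer {garside ^ 2} := by
    have : (⊤ : Subgroup Braid3) ≤ Subgroup.centralizer {garside ^ 2} := by
      rw [← PresentedGroup.closure_range_of, Subgroup.closure_le]
      rintro _ ⟨i, rfl⟩
      rw [SetLike.mem_coe, Subgroup.mem_centralizer_singleton_iff]
      fin_cases i
      · exact h0.eq.symm
      · exact h1.eq.symm
    exact this trivial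
  exact (Subgroup.mem_centralizer_singleton_iff.1 this).symm

theorem garside_pow_commute (k : ℕ) (w : Braid3) : Commute (garside ^ (2 * k)) w := by
  rw [pow_mul]
  exact (garside_sq_commute w).pow_left k

theorem sigma_zero_one_cube : (σ 0 * σ 1) ^ 3 = garside ^ 2 := by
  have : (σ 0 * σ 1) ^ 3 = (σ 0 * σ 1 * σ 0) * (σ 1 * σ 0 * σ 1) := by
    simp only [pow_succ, pow_zero, one_mul, mul_assoc]
  rw [this, ← braid_rel, pow_two, garside]

theorem sigma_zero_eq : σ 0 = garside ^ 2 * (block 1 * block 0) := by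
  rw [(garside_sq_commute _).eq, block, block]
  group

theorem sigma_one_eq : σ 1 = garside ^ 2 * (block 0 * block 1) := by
  have h : σ 1 = garside * σ 0 * garside⁻¹ := by rw [garside_mul_sigma_zero]; group
  rw [h, block, block]
  group

theorem block_mul_zero_mul (p q : ℕ) :
    garside ^ 2 * (block p * block 0 * block q) = block (p + q) := by
  rw [(garside_sq_commute _).eq]
  have : block p * block 0 * block q = σ 0 ^ p * ((garside ^ 2)⁻¹ * σ 0 ^ q) * garside⁻¹ := by
    unfold block; group
  rw [this, (garside_sq_commute _).inv_left.eq, block, pow_add]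
  group

/-- Moving Δ⁻¹ to the right swaps the generators, so the left side is σ₁σ₂σ₁ Δ⁻². This identity is
what removes blocks of exponent 1. -/
theorem garside_inv_eq : σ 0 * garside⁻¹ * σ 0 * garside⁻¹ * σ 0 = garside⁻¹ := by
  have h : garside⁻¹ * σ 0 = σ 1 * garside⁻¹ := by
    rw [inv_mul_eq_iff_eq_mul, ← mul_assoc, garside_mul_sigma_one]; group
  have h' : garside⁻¹ * σ 1 = σ 0 * garside⁻¹ := by
    rw [inv_mul_eq_iff_eq_mul, ← mul_assoc, garside_mul_sigma_zero]; group
  calc σ 0 * garside⁻¹ * σ 0 * garside⁻¹ * σ 0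
      = σ 0 * (garside⁻¹ * σ 0) * (garside⁻¹ * σ 0) := by group
    _ = σ 0 * σ 1 * (garside⁻¹ * σ 1) * garside⁻¹ := by rw [h]; group
    _ = garside * garside⁻¹ * garside⁻¹ := by rw [h', garside]; group
    _ = garside⁻¹ := by group

theorem block_succ_mul_one_mul_succ (p q : ℕ) :
    block (p + 1) * block 1 * block (q + 1) = block p * block q := by
  calc block (p + 1) * block 1 * block (q + 1)
      = σ 0 ^ p * (σ 0 * garside⁻¹ * σ 0 * garside⁻¹ * σ 0) * (σ 0 ^ q * garside⁻¹) := by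
        rw [block, block, block, pow_succ, pow_succ']; group
    _ = _ := by rw [garside_inv_eq, block, block]

theorem isConj_block_add_two_mul_one (p : ℕ) : IsConj (block (p + 2) * block 1) (block p) := by
  refine isConj_iff.2 ⟨(σ 0)⁻¹, ?_⟩
  calc (σ 0)⁻¹ * (block (p + 2) * block 1) * (σ 0)⁻¹⁻¹
      = σ 0 ^ p * (σ 0 * garside⁻¹ * σ 0 * garside⁻¹ * σ 0) := by
        rw [block, block, pow_succ', pow_succ]; group
    _ = block p := by rw [garside_inv_eq, block]

theorem block_one_cube : block 1 ^ 3 = (garside ^ 2)⁻¹ := by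
  have h := block_succ_mul_one_mul_succ 0 0
  rw [zero_add] at h
  rw [pow_succ, pow_two, h]
  simp [block, pow_two]

theorem blockProd_append (l l' : List ℕ) : blockProd (l ++ l') = blockProd l * blockProd l' := by
  simp [blockProd]

theorem blockProd_cons (p : ℕ) (l : List ℕ) : blockProd (p :: l) = block p * blockProd l := by
  simp [blockProd]

theorem isConj_mul_comm (x y : Braid3) : IsConj (x * y) (y * x) :=
  isConj_iff.2 ⟨y, by group⟩

/-- Multiplying conjugate braids by a power of `Δ²` gives conjugate braids. -/
theorem isConj_garside_mul {x y : Braid3} (k : ℕ) (h : IsConj x y) :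
    IsConj (garside ^ (2 * k) * x) (garside ^ (2 * k) * y) := by
  obtain ⟨c, hc⟩ := isConj_iff.1 h
  refine isConj_iff.2 ⟨c, ?_⟩
  rw [← hc, ← mul_assoc, ← (garside_pow_commute k c).eq]
  group

theorem exists_blockProd_of_isPositive {w : Braid3} (hw : IsPositive w) :
    ∃ (k : ℕ) (l : List ℕ), l.length ≤ 2 * k ∧ w = garside ^ (2 * k) * blockProd l := by
  induction hw using Submonoid.closure_induction with
  | mem x hx =>
    obtain ⟨i, rfl⟩ := hx
    fin_cases i
    · exact ⟨1, [1, 0], by simp, by simpa [blockProd] using sigma_zero_eq⟩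
    · exact ⟨1, [0, 1], by simp, by simpa [blockProd] using sigma_one_eq⟩
  | one => exact ⟨0, [], by simp, by simp [blockProd]⟩
  | mul x y _ _ hx hy =>
    obtain ⟨k, l, hl, rfl⟩ := hx
    obtain ⟨k', l', hl', rfl⟩ := hy
    refine ⟨k + k', l ++ l', by simp; omega, ?_⟩
    rw [mul_add, pow_add, blockProd_append, mul_assoc, ← mul_assoc (blockProd l),
      ← (garside_pow_commute k' _).eq]
    group

/-- The normal forms of a positive braid: up to conjugation it is a product of blocks with
exponents at least two, unless its permutation has order at most two or its cube is a power of
the full twist. -/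
theorem normalForm_of_length (m : ℕ) : ∀ (l : List ℕ) (k : ℕ) (w : Braid3), l.length = m →
    m ≤ 2 * k → IsConj w (garside ^ (2 * k) * blockProd l) → strandPerm w ^ 2 ≠ 1 →
    (∃ j : ℕ, w ^ 3 = garside ^ (2 * j)) ∨
    ∃ (k : ℕ) (l : List ℕ), l.length ≤ 2 * k ∧ l ≠ [] ∧ (∀ p ∈ l, 2 ≤ p) ∧
      IsConj w (garside ^ (2 * k) * blockProd l) := by
  induction m using Nat.strong_induction_on with
  | _ m ih =>
  intro l k w hl hk hw hperm
  have hnot : ∀ v, IsConj w v → strandPerm v ^ 2 ≠ 1 := by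
    intro v hv h
    obtain ⟨c, hc⟩ := isConj_iff.1 hv
    apply hperm
    rw [← hc, ← map_pow, conj_pow, map_mul, map_mul, map_inv, conj_eq_one_iff, map_pow] at h
    exact h
  have hcube : ∀ (v : Braid3) (j : ℕ), IsConj w v → v ^ 3 = garside ^ (2 * j) →
      w ^ 3 = garside ^ (2 * j) := by
    intro v j hv h
    obtain ⟨c, hc⟩ := isConj_iff.1 hv.symm
    rw [← hc, conj_pow, h, ← (garside_pow_commute j c).eq]
    group
  have hg : strandPerm garside ^ 2 = 1 := by
    simp only [garside, map_mul, strandPerm, σ, PresentedGroup.toGroup.of]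
    decide
  have hg' : ∀ k : ℕ, strandPerm (garside ^ (2 * k)) = 1 := by
    intro k
    rw [pow_mul, map_pow, map_pow, hg, one_pow]
  have hs : strandPerm (σ 0) ^ 2 = 1 := by
    simp only [strandPerm, σ, PresentedGroup.toGroup.of]
    decide
  -- A block Δ⁻¹, rotated cyclically between two others, merges them at the cost of one Δ²: `k`
  -- drops by one and the length by two, so the bound `m ≤ 2 * k` survives.
  by_cases h0 : 0 ∈ l
  · obtain ⟨l₁, l₂, rfl⟩ := List.append_of_mem h0
    have hw' : IsConj w (garside ^ (2 * k) * blockProd (0 :: (l₂ ++ l₁))) := by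
      refine hw.trans (isConj_garside_mul k ?_)
      rw [blockProd_append, ← List.cons_append, blockProd_append]
      exact isConj_mul_comm _ _
    have hlen : (l₂ ++ l₁).length + 1 = m := by
      rw [← hl]; simp; omega
    generalize l₂ ++ l₁ = L at hw' hlen
    obtain ⟨k, rfl⟩ : ∃ k', k = k' + 1 := ⟨k - 1, by omega⟩
    rcases List.eq_nil_or_concat' L with rfl | ⟨L, p, rfl⟩
    · refine absurd ?_ (hnot _ hw')
      rw [map_mul, hg']
      simp [blockProd, block, hg]
    · have hw2 : IsConj w (garside ^ (2 * (k + 1)) * blockProd (p :: 0 :: L)) := by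
        refine hw'.trans (isConj_garside_mul _ ?_)
        rw [← List.cons_append, blockProd_append, blockProd_cons p]
        simpa [blockProd] using isConj_mul_comm (blockProd (0 :: L)) (block p)
      rcases L with _ | ⟨q, L⟩
      -- Here the braid is conjugate to a power of Δ² times a power of σ₁, whose permutation has
      -- order at most two.
      · refine absurd ?_ (hnot _ hw2)
        have : garside ^ (2 * (k + 1)) * blockProd [p, 0] = garside ^ (2 * k) * σ 0 ^ p := by
          have : blockProd [p, 0] = σ 0 ^ p * (garside ^ 2)⁻¹ := by
            simp only [blockProd, List.map, List.prod_cons, List.prod_nil, block]; group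
          rw [this, ← (garside_sq_commute _).inv_left.eq, mul_add, pow_add]
          group
        rw [this, map_mul, hg', one_mul, map_pow, ← pow_mul, mul_comm, pow_mul, hs, one_pow]
      · refine ih (m - 2) (by omega) ((p + q) :: L) k w (by simp at hlen ⊢; omega) (by omega) ?_
          hperm
        have : garside ^ (2 * (k + 1)) * blockProd (p :: 0 :: q :: L) =
            garside ^ (2 * k) * blockProd ((p + q) :: L) := by
          rw [blockProd_cons (p + q), ← block_mul_zero_mul, mul_add, pow_add]
          simp only [blockProd_cons, mul_assoc, mul_one]
        rwa [this] at hw2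
  by_cases h1 : 1 ∈ l
  · obtain ⟨l₁, l₂, rfl⟩ := List.append_of_mem h1
    have hw' : IsConj w (garside ^ (2 * k) * blockProd (1 :: (l₂ ++ l₁))) := by
      refine hw.trans (isConj_garside_mul k ?_)
      rw [blockProd_append, ← List.cons_append, blockProd_append]
      exact isConj_mul_comm _ _
    have hlen : (l₂ ++ l₁).length + 1 = m := by
      rw [← hl]; simp; omega
    -- The neighbours of the block of exponent 1 have positive exponents, so each can be lowered by
    -- one.
    have hpos : ∀ p ∈ l₂ ++ l₁, p ≠ 0 := by
      rintro p hp rfl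
      apply h0
      simp at hp ⊢
      tauto
    generalize l₂ ++ l₁ = L at hw' hlen hpos
    rcases List.eq_nil_or_concat' L with rfl | ⟨L, p, rfl⟩
    -- The cube of Δ^(2k) · `block 1` is Δ^(6k) Δ⁻²; the subtraction is genuine because the list is
    -- non-empty and so `k ≥ 1`.
    · refine Or.inl ⟨3 * k - 1, hcube _ _ hw' ?_⟩
      rw [(garside_pow_commute k _).mul_pow]
      simp only [blockProd, List.map, List.prod_cons, List.prod_nil, mul_one, block_one_cube]
      rw [← pow_mul, mul_inv_eq_iff_eq_mul, ← pow_add]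
      congr 1
      omega
    · have hw2 : IsConj w (garside ^ (2 * k) * blockProd (p :: 1 :: L)) := by
        refine hw'.trans (isConj_garside_mul _ ?_)
        rw [← List.cons_append, blockProd_append, blockProd_cons p]
        simpa [blockProd] using isConj_mul_comm (blockProd (1 :: L)) (block p)
      obtain ⟨p, rfl⟩ : ∃ p', p = p' + 1 := Nat.exists_eq_succ_of_ne_zero (hpos p (by simp))
      rcases L with _ | ⟨q, L⟩
      · rcases p with _ | p
        -- Two blocks of exponent 1 remain, and the sixth power of `block 1` is Δ⁻⁴.
        · refine Or.inl ⟨3 * k - 2, hcube _ _ hw2 ?_⟩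
          rw [(garside_pow_commute k _).mul_pow]
          simp only [blockProd, List.map, List.prod_cons, List.prod_nil, mul_one, zero_add]
          rw [← pow_two, pow_right_comm (block 1), block_one_cube, inv_pow, ← pow_mul,
            ← pow_mul, mul_inv_eq_iff_eq_mul, ← pow_add]
          congr 1
          simp at hlen
          omega
        · refine ih (m - 1) (by omega) [p] k w (by simp at hlen ⊢; omega) (by omega) ?_ hperm
          refine hw2.trans (isConj_garside_mul _ ?_)
          simpa [blockProd] using isConj_block_add_two_mul_one p
      · obtain ⟨q, rfl⟩ : ∃ q', q = q' + 1 := Nat.exists_eq_succ_of_ne_zero (hpos q (by simp))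
        refine ih (m - 1) (by omega) (p :: q :: L) k w (by simp at hlen ⊢; omega) (by omega) ?_
          hperm
        have : blockProd ((p + 1) :: 1 :: (q + 1) :: L) = blockProd (p :: q :: L) := by
          simp only [blockProd_cons, ← mul_assoc, block_succ_mul_one_mul_succ]
        rwa [this] at hw2
  · by_cases hnil : l = []
    · refine absurd ?_ (hnot _ hw)
      subst hnil
      rw [map_mul, hg']
      simp [blockProd]
    · refine Or.inr ⟨k, l, by omega, hnil, fun p hp => ?_, hw⟩
      have : p ≠ 0 := fun h => h0 (h ▸ hp)
      have : p ≠ 1 := fun h => h1 (h ▸ hp)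
      omega

/-- A block of exponent 2 has the same permutation as Δ, a transposition; a product of such blocks
and powers of Δ² has a permutation of order at most two. -/
theorem exists_three_le {w : Braid3} {k : ℕ} {l : List ℕ} (hl : ∀ p ∈ l, 2 ≤ p)
    (hw : IsConj w (garside ^ (2 * k) * blockProd l)) (hperm : strandPerm w ^ 2 ≠ 1) :
    ∃ p ∈ l, 3 ≤ p := by
  by_contra! h
  have hl2 : ∀ p ∈ l, p = 2 := fun p hp => by have := hl p hp; have := h p hp; omega
  have hs : strandPerm (block 2) = strandPerm garside := by
    simp only [block, garside, map_mul, map_pow, map_inv, strandPerm, σ, PresentedGroup.toGroup.of]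
    decide
  have hg : strandPerm garside ^ 2 = 1 := by
    simp only [garside, map_mul, strandPerm, σ, PresentedGroup.toGroup.of]
    decide
  have hl3 : strandPerm (blockProd l) = strandPerm garside ^ l.length := by
    rw [List.eq_replicate_of_mem hl2, blockProd, List.map_replicate, List.prod_replicate, map_pow,
      hs, List.length_replicate]
  obtain ⟨c, hc⟩ := isConj_iff.1 hw.symm
  apply hperm
  rw [← hc, ← map_pow, conj_pow, map_mul, map_mul, map_inv, conj_eq_one_iff, map_pow, map_mul,
    map_pow, hl3, ← pow_add, ← pow_mul, mul_comm, pow_mul, hg, one_pow]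

/-! ### The permutation of a braid whose closure is a knot -/

/-- A transitive permutation has no fixed point, and a permutation of three points without fixed
points is a 3-cycle. -/
theorem strandPerm_of_closureIsKnot {w : Braid3} (hw : ClosureIsKnot w) :
    strandPerm w ^ 2 ≠ 1 ∧ strandPerm w ^ 3 = 1 := by
  have hsub : Subsingleton (ClosureComponents w) := by
    have := (Nat.card_eq_one_iff_unique.1 hw).1
    exact this
  have hfix : ∀ x, strandPerm w x ≠ x := by
    intro x hx
    obtain ⟨y, hy⟩ : ∃ y, y ≠ x := exists_ne x
    have h : (Quotient.mk'' y : ClosureComponents w) = Quotient.mk'' x :=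
      hsub.elim _ _
    rw [Quotient.eq''] at h
    obtain ⟨⟨g, hg⟩, h⟩ := MulAction.orbitRel_apply.1 h
    obtain ⟨n, rfl⟩ := Subgroup.mem_zpowers_iff.1 hg
    apply hy
    have h : (strandPerm w ^ n) x = y := h
    rw [← h]
    exact Function.IsFixedPt.perm_zpow hx n
  revert hfix
  generalize strandPerm w = g
  revert g
  decide

/-! ### Isotopies that follow a motion of three points -/

theorem continuous_complex_mk {X : Type*} [TopologicalSpace X] {f g : X → ℝ} (hf : Continuous f)
    (hg : Continuous g) : Continuous fun x => (⟨f x, g x⟩ : ℂ) := by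
  simp only [Complex.mk_eq_add_mul_I]
  fun_prop

/-- Three points in the plane such that the second is to the left of the third, and the first is
neither of the two nor vertically below one of them. -/
structure Admissible (x₁ x₂ x₃ : ℂ) : Prop where
  re_lt : x₂.re < x₃.re
  im_lt₂ : x₁.re = x₂.re → x₂.im < x₁.im
  im_lt₃ : x₁.re = x₃.re → x₃.im < x₁.im

/-- The linear function whose graph contains `x₂` and `x₃`. -/
def chord (x₂ x₃ : ℂ) (p : ℝ) : ℝ :=
  x₂.im + (x₃.im - x₂.im) * ((p - x₂.re) / (x₃.re - x₂.re))

/-- A function whose graph contains `x₂` and `x₃`, and that is far below the chord elsewhere if `K`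
is large. -/
def barrier (K : ℝ) (x₂ x₃ : ℂ) (p : ℝ) : ℝ :=
  chord x₂ x₃ p - K * (|p - x₂.re| * |p - x₃.re|)

theorem barrier_left (K : ℝ) (x₂ x₃ : ℂ) : barrier K x₂ x₃ x₂.re = x₂.im := by
  simp [barrier, chord]

theorem barrier_right (K : ℝ) {x₂ x₃ : ℂ} (h : x₂.re < x₃.re) :
    barrier K x₂ x₃ x₃.re = x₃.im := by
  rw [barrier, chord, div_self (by linarith)]
  simp

/-- The abscissa of the image of a point under `frameHomeo`. -/
def frameRe (x₁ x₂ x₃ z : ℂ) : ℝ :=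
  x₂.re + (x₃.re - x₂.re) * z.re + (x₁.re - x₂.re) * z.im

/-- The ordinate of the preimage of a point under `frameHomeo`. -/
def frameInvIm (K : ℝ) (x₁ x₂ x₃ z : ℂ) : ℝ :=
  (z.im - barrier K x₂ x₃ z.re) / (x₁.im - barrier K x₂ x₃ x₁.re)

theorem continuous_barrier {X : Type*} [TopologicalSpace X] (K : ℝ) {x₂ x₃ : X → ℂ} {p : X → ℝ}
    (h₂ : Continuous x₂) (h₃ : Continuous x₃) (hp : Continuous p)
    (h : ∀ u, (x₂ u).re < (x₃ u).re) :
    Continuous fun u => barrier K (x₂ u) (x₃ u) (p u) := by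
  have h' : ∀ u, (x₃ u).re - (x₂ u).re ≠ 0 := fun u => by linarith [h u]
  unfold barrier chord
  fun_prop (disch := exact h')

theorem continuous_frame {X : Type*} [TopologicalSpace X] (K : ℝ) {x₁ x₂ x₃ z : X → ℂ}
    (h₁ : Continuous x₁) (h₂ : Continuous x₂) (h₃ : Continuous x₃) (hz : Continuous z)
    (h : ∀ u, (x₂ u).re < (x₃ u).re) :
    Continuous fun u => (⟨frameRe (x₁ u) (x₂ u) (x₃ u) (z u),
      ((x₁ u).im - barrier K (x₂ u) (x₃ u) (x₁ u).re) * (z u).im +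
        barrier K (x₂ u) (x₃ u) (frameRe (x₁ u) (x₂ u) (x₃ u) (z u))⟩ : ℂ) := by
  have hre : Continuous fun u => frameRe (x₁ u) (x₂ u) (x₃ u) (z u) := by
    unfold frameRe
    fun_prop
  have hb := continuous_barrier K h₂ h₃ (Complex.continuous_re.comp h₁) h
  have hb' := continuous_barrier K h₂ h₃ hre h
  refine continuous_complex_mk hre ?_
  exact (((Complex.continuous_im.comp h₁).sub hb).mul (Complex.continuous_im.comp hz)).add hb'

theorem continuous_frameInv {X : Type*} [TopologicalSpace X] (K : ℝ) {x₁ x₂ x₃ z : X → ℂ}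
    (h₁ : Continuous x₁) (h₂ : Continuous x₂) (h₃ : Continuous x₃) (hz : Continuous z)
    (h : ∀ u, (x₂ u).re < (x₃ u).re)
    (hK : ∀ u, barrier K (x₂ u) (x₃ u) (x₁ u).re < (x₁ u).im) :
    Continuous fun u => (⟨((z u).re - (x₂ u).re - ((x₁ u).re - (x₂ u).re) *
        frameInvIm K (x₁ u) (x₂ u) (x₃ u) (z u)) / ((x₃ u).re - (x₂ u).re),
      frameInvIm K (x₁ u) (x₂ u) (x₃ u) (z u)⟩ : ℂ) := by
  have hb := continuous_barrier K h₂ h₃ (Complex.continuous_re.comp h₁) h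
  have hb' := continuous_barrier K h₂ h₃ (Complex.continuous_re.comp hz) h
  have him : Continuous fun u => frameInvIm K (x₁ u) (x₂ u) (x₃ u) (z u) :=
    ((Complex.continuous_im.comp hz).sub hb').div ((Complex.continuous_im.comp h₁).sub hb)
      fun u => (sub_pos.2 (hK u)).ne'
  have h' : ∀ u, (x₃ u).re - (x₂ u).re ≠ 0 := fun u => by linarith [h u]
  refine continuous_complex_mk ?_ him
  fun_prop (disch := exact h')

/-- A homeomorphism of the plane that maps `I, 0, 1` to the given points `x₁, x₂, x₃`. -/
def frameHomeo (K : ℝ) (x₁ x₂ x₃ : ℂ) (h : x₂.re < x₃.re)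
    (hK : barrier K x₂ x₃ x₁.re < x₁.im) : ℂ ≃ₜ ℂ where
  -- The real axis goes to the graph of the barrier, which passes through `x₂` and `x₃`; since `x₁`
  -- lies above this graph, the vertical scale is positive.
  toFun z := ⟨frameRe x₁ x₂ x₃ z, (x₁.im - barrier K x₂ x₃ x₁.re) * z.im +
    barrier K x₂ x₃ (frameRe x₁ x₂ x₃ z)⟩
  invFun z := ⟨(z.re - x₂.re - (x₁.re - x₂.re) * frameInvIm K x₁ x₂ x₃ z) / (x₃.re - x₂.re),
    frameInvIm K x₁ x₂ x₃ z⟩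
  left_inv z := by
    have h1 : x₃.re - x₂.re ≠ 0 := by linarith
    have h2 : x₁.im - barrier K x₂ x₃ x₁.re ≠ 0 := by linarith
    have h3 : frameInvIm K x₁ x₂ x₃ ⟨frameRe x₁ x₂ x₃ z, (x₁.im - barrier K x₂ x₃ x₁.re) * z.im +
        barrier K x₂ x₃ (frameRe x₁ x₂ x₃ z)⟩ = z.im := by
      simp [frameInvIm, h2]
    apply Complex.ext
    · simp only [h3]
      rw [frameRe]
      field_simp
      ring
    · exact h3
  right_inv z := by
    have h1 : x₃.re - x₂.re ≠ 0 := by linarith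
    have h2 : x₁.im - barrier K x₂ x₃ x₁.re ≠ 0 := by linarith
    have h3 : frameRe x₁ x₂ x₃ ⟨(z.re - x₂.re - (x₁.re - x₂.re) * frameInvIm K x₁ x₂ x₃ z) /
        (x₃.re - x₂.re), frameInvIm K x₁ x₂ x₃ z⟩ = z.re := by
      simp only [frameRe]
      field_simp
      ring
    apply Complex.ext
    · exact h3
    · simp only [h3]
      rw [frameInvIm]
      field_simp
      ring
  continuous_toFun := continuous_frame K continuous_const continuous_const continuous_const
    continuous_id fun _ => h
  continuous_invFun := continuous_frameInv K continuous_const continuous_const continuous_const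
    continuous_id (fun _ => h) fun _ => hK

section

variable {K : ℝ} {x₁ x₂ x₃ : ℂ} (h : x₂.re < x₃.re) (hK : barrier K x₂ x₃ x₁.re < x₁.im)

theorem frameHomeo_I : frameHomeo K x₁ x₂ x₃ h hK Complex.I = x₁ := by
  apply Complex.ext <;> simp [frameHomeo, frameRe]

theorem frameHomeo_zero : frameHomeo K x₁ x₂ x₃ h hK 0 = x₂ := by
  apply Complex.ext <;> simp [frameHomeo, frameRe, barrier_left]

theorem frameHomeo_one : frameHomeo K x₁ x₂ x₃ h hK 1 = x₃ := by
  apply Complex.ext <;> simp [frameHomeo, frameRe, barrier_right K h]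

end

/-- For a motion of admissible triples the constant of the barrier can be chosen uniformly. -/
theorem exists_barrier_lt {x₁ x₂ x₃ : unitInterval → ℂ} (h₁ : Continuous x₁) (h₂ : Continuous x₂)
    (h₃ : Continuous x₃) (h : ∀ u, Admissible (x₁ u) (x₂ u) (x₃ u)) :
    ∃ n : ℕ, ∀ K : ℝ, n ≤ K → ∀ u, barrier K (x₂ u) (x₃ u) (x₁ u).re < (x₁ u).im := by
  have hmono : ∀ (K K' : ℝ), K ≤ K' → ∀ u, barrier K (x₂ u) (x₃ u) (x₁ u).re < (x₁ u).im →
      barrier K' (x₂ u) (x₃ u) (x₁ u).re < (x₁ u).im := by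
    intro K K' hK u hu
    refine lt_of_le_of_lt ?_ hu
    unfold barrier
    gcongr
  -- For each `u` some `n` works: the barrier falls without bound as `K` grows, except at the
  -- abscissas of `x₂` and `x₃`, where admissibility applies. The resulting sets are open and
  -- increase with `n`.
  obtain ⟨n, hn⟩ := isCompact_univ.elim_directed_cover
    (fun n : ℕ => {u | barrier n (x₂ u) (x₃ u) (x₁ u).re < (x₁ u).im})
    (fun n => isOpen_lt (continuous_barrier _ h₂ h₃ (Complex.continuous_re.comp h₁)
      fun u => (h u).re_lt) (Complex.continuous_im.comp h₁))
    (fun u _ => by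
      rw [Set.mem_iUnion]
      by_cases e2 : (x₁ u).re = (x₂ u).re
      · exact ⟨0, by simpa [e2, barrier_left] using (h u).im_lt₂ e2⟩
      by_cases e3 : (x₁ u).re = (x₃ u).re
      · exact ⟨0, by simpa [e3, barrier_right _ (h u).re_lt] using (h u).im_lt₃ e3⟩
      have hD : 0 < |(x₁ u).re - (x₂ u).re| * |(x₁ u).re - (x₃ u).re| :=
        mul_pos (abs_pos.2 (sub_ne_zero.2 e2)) (abs_pos.2 (sub_ne_zero.2 e3))
      obtain ⟨n, hn⟩ := exists_nat_gt ((chord (x₂ u) (x₃ u) (x₁ u).re - (x₁ u).im) /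
        (|(x₁ u).re - (x₂ u).re| * |(x₁ u).re - (x₃ u).re|))
      rw [div_lt_iff₀ hD] at hn
      refine ⟨n, ?_⟩
      rw [Set.mem_ofPred_eq, barrier]
      linarith)
    (directed_of_isDirected_le fun m n hmn u hu =>
      hmono _ _ (Nat.cast_le.2 hmn) u hu)
  exact ⟨n, fun K hK u => hmono _ _ hK u (hn (Set.mem_univ u))⟩

/-- Two isotopies of the plane that start at the identity and move three points through admissible
triples, with the same final positions: their final homeomorphisms are isotopic relative to the
three points. -/
theorem exists_isotopy_of_admissible {F k : unitInterval → ℂ ≃ₜ ℂ} {p₁ p₂ p₃ : ℂ}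
    (hF : Continuous fun q : unitInterval × ℂ => F q.1 q.2)
    (hF' : Continuous fun q : unitInterval × ℂ => (F q.1)⁻¹ q.2)
    (hk : Continuous fun q : unitInterval × ℂ => k q.1 q.2)
    (hF0 : F 0 = 1) (hk0 : k 0 = 1)
    (hFa : ∀ u, Admissible (F u p₁) (F u p₂) (F u p₃))
    (hka : ∀ u, Admissible (k u p₁) (k u p₂) (k u p₃))
    (h₁ : F 1 p₁ = k 1 p₁) (h₂ : F 1 p₂ = k 1 p₂) (h₃ : F 1 p₃ = k 1 p₃) :
    ∃ H : unitInterval → ℂ ≃ₜ ℂ, Continuous (fun q : unitInterval × ℂ => H q.1 q.2) ∧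
      H 0 = F 1 ∧ H 1 = k 1 ∧ ∀ u, H u p₁ = F 1 p₁ ∧ H u p₂ = F 1 p₂ ∧ H u p₃ = F 1 p₃ := by
  have hFp : ∀ p, Continuous fun u => F u p := fun p =>
    hF.comp (by fun_prop : Continuous fun u => (u, p))
  have hkp : ∀ p, Continuous fun u => k u p := fun p =>
    hk.comp (by fun_prop : Continuous fun u => (u, p))
  obtain ⟨m, hm⟩ := exists_barrier_lt (hFp p₁) (hFp p₂) (hFp p₃) hFa
  obtain ⟨n, hn⟩ := exists_barrier_lt (hkp p₁) (hkp p₂) (hkp p₃) hka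
  -- One constant for both motions makes the frames `G` and `G'` coincide whenever the triples do,
  -- that is, at both ends.
  set K : ℝ := max m n
  have hm := hm K (le_max_left _ _)
  have hn := hn K (le_max_right _ _)
  let G : unitInterval → ℂ ≃ₜ ℂ := fun u =>
    frameHomeo K (F u p₁) (F u p₂) (F u p₃) (hFa u).re_lt (hm u)
  let G' : unitInterval → ℂ ≃ₜ ℂ := fun u =>
    frameHomeo K (k u p₁) (k u p₂) (k u p₃) (hka u).re_lt (hn u)
  have hG : Continuous fun q : unitInterval × ℂ => G q.1 q.2 :=
    continuous_frame K ((hFp p₁).comp continuous_fst) ((hFp p₂).comp continuous_fst)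
      ((hFp p₃).comp continuous_fst) continuous_snd fun q => (hFa q.1).re_lt
  have hG' : Continuous fun q : unitInterval × ℂ => (G' q.1)⁻¹ q.2 :=
    continuous_frameInv K ((hkp p₁).comp continuous_fst) ((hkp p₂).comp continuous_fst)
      ((hkp p₃).comp continuous_fst) continuous_snd (fun q => (hka q.1).re_lt) fun q => hn q.1
  have key : ∀ u (p q : ℂ), G' u q = k u p → G u q = F u p →
      (F 1 * ((F u)⁻¹ * (G u * ((G' u)⁻¹ * k u)))) p = F 1 p := by
    intro u p q h h'
    have e1 : (G' u)⁻¹ (k u p) = q := by rw [← h]; exact (G' u).symm_apply_apply q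
    have e2 : (F u)⁻¹ (F u p) = p := (F u).symm_apply_apply p
    simp only [Homeomorph.mul_apply, e1, h', e2]
  -- `k u` moves the points along the second motion, the frames carry the result to the first
  -- motion, and `(F u)⁻¹` brings it back. Hence each `pᵢ` ends at `F 1 pᵢ` for every `u`.
  refine ⟨fun u => F 1 * ((F u)⁻¹ * (G u * ((G' u)⁻¹ * k u))), ?_, ?_, ?_, fun u => ⟨?_, ?_, ?_⟩⟩
  · have a1 := hG'.comp (continuous_fst.prodMk hk)
    have a2 := hG.comp (continuous_fst.prodMk a1)
    have a3 := hF'.comp (continuous_fst.prodMk a2)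
    exact (F 1).continuous.comp a3
  · have : G 0 = G' 0 := by simp only [G, G', hF0, hk0]
    simp only [this, hF0, hk0]
    group
  · have : G 1 = G' 1 := by simp only [G, G', h₁, h₂, h₃]
    simp only [this]
    group
  · exact key u p₁ Complex.I (frameHomeo_I _ _) (frameHomeo_I _ _)
  · exact key u p₂ 0 (frameHomeo_zero _ _) (frameHomeo_zero _ _)
  · exact key u p₃ 1 (frameHomeo_one _ _) (frameHomeo_one _ _)

/-! ### The motion of the punctures under two half twists -/

/-- The homeomorphism `twistFun a c`. -/
def twist (a : ℝ) (c : ℂ) : ℂ ≃ₜ ℂ where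
  toFun := twistFun a c
  invFun := twistFun (-a) c
  left_inv := twistFun_neg_twistFun a c
  right_inv z := by simpa using twistFun_neg_twistFun (-a) c z
  continuous_toFun := continuous_twistFun a c
  continuous_invFun := continuous_twistFun (-a) c

theorem halfTwist_eq (c : ℂ) : halfTwist c = twist Real.pi c := rfl

theorem twist_inv (a : ℝ) (c : ℂ) : (twist a c)⁻¹ = twist (-a) c := Homeomorph.ext fun _ => rfl

theorem twist_zero (c : ℂ) : twist 0 c = 1 := by
  ext z
  simp [twist, twistFun]

theorem twist_apply_of_norm {a : ℝ} {c z : ℂ} (h : ‖z - c‖ = 1 / 2) :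
    twist a c z = c + ⟨Real.cos a, Real.sin a⟩ * (z - c) := by
  change twistFun a c z = _
  rw [twistFun, h, Complex.exp_mul_I, ← Complex.ofReal_cos, ← Complex.ofReal_sin,
    Complex.mk_eq_add_mul_I]
  norm_num

theorem twist_apply_of_one_le {a : ℝ} {c z : ℂ} (h : 1 ≤ ‖z - c‖) : twist a c z = z := by
  change twistFun a c z = _
  rw [twistFun, max_eq_left]
  · simp
  · exact (min_le_right _ _).trans (by linarith)

theorem continuous_twist {X : Type*} [TopologicalSpace X] {a : X → ℝ} {z : X → ℂ} (c : ℂ)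
    (ha : Continuous a) (hz : Continuous z) : Continuous fun u => twist (a u) c (z u) := by
  change Continuous fun u => twistFun (a u) c (z u)
  unfold twistFun
  fun_prop

/-- The isotopy that performs first the half twist about `1 / 2` and then the one about
`-(1 / 2)`. -/
def twistMotion (u : unitInterval) : ℂ ≃ₜ ℂ :=
  twist (Real.pi * max 0 (2 * (u : ℝ) - 1)) (-(1 / 2)) * twist (Real.pi * min 1 (2 * (u : ℝ))) (1 / 2)

theorem twist_left_zero (a : ℝ) :
    twist a (-(1 / 2)) 0 = ⟨(Real.cos a - 1) / 2, Real.sin a / 2⟩ := by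
  rw [twist_apply_of_norm (by norm_num)]
  apply Complex.ext <;> simp <;> ring

theorem twist_left_neg_one (a : ℝ) :
    twist a (-(1 / 2)) (-1) = ⟨(-Real.cos a - 1) / 2, -Real.sin a / 2⟩ := by
  rw [twist_apply_of_norm (by norm_num)]
  apply Complex.ext <;> norm_num <;> ring

theorem twist_left_one (a : ℝ) : twist a (-(1 / 2)) 1 = 1 :=
  twist_apply_of_one_le (by norm_num)

theorem twist_right_zero (a : ℝ) :
    twist a (1 / 2) 0 = ⟨(1 - Real.cos a) / 2, -Real.sin a / 2⟩ := by
  rw [twist_apply_of_norm (by norm_num)]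
  apply Complex.ext <;> norm_num <;> ring

theorem twist_right_one (a : ℝ) :
    twist a (1 / 2) 1 = ⟨(1 + Real.cos a) / 2, Real.sin a / 2⟩ := by
  rw [twist_apply_of_norm (by norm_num)]
  apply Complex.ext <;> norm_num <;> ring

theorem twist_right_neg_one (a : ℝ) : twist a (1 / 2) (-1) = -1 :=
  twist_apply_of_one_le (by norm_num)

/-- The puncture starting at `1` travels to `-1` through the closed upper half-plane, while the
other two stay in the closed lower one and shift to the right, one after the other. -/
theorem twistMotion_admissible (u : unitInterval) :
    Admissible (twistMotion u 1) (twistMotion u (-1)) (twistMotion u 0) := by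
  have hu0 := u.2.1
  have hu1 := u.2.2
  have hpi := Real.pi_pos
  rcases le_total (u : ℝ) (1 / 2) with hu | hu
  · have e : twistMotion u = twist (Real.pi * (2 * u)) (1 / 2) := by
      rw [twistMotion, max_eq_left (by linarith), min_eq_right (by linarith), mul_zero, twist_zero,
        one_mul]
    have hs : 0 ≤ Real.sin (Real.pi * (2 * u)) :=
      Real.sin_nonneg_of_nonneg_of_le_pi (by positivity) (by nlinarith)
    have hsc := Real.sin_sq_add_cos_sq (Real.pi * (2 * u))
    rw [e, twist_right_neg_one, twist_right_one, twist_right_zero]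
    generalize Real.sin (Real.pi * (2 * u)) = s at *
    generalize Real.cos (Real.pi * (2 * u)) = c at *
    constructor
    · simp only [Complex.neg_re, Complex.one_re]; nlinarith
    · simp only [Complex.neg_re, Complex.one_re]; intro h; nlinarith
    · simp only; intro h
      have : c = 0 := by linarith
      nlinarith
  · have e : twistMotion u = twist (Real.pi * (2 * u - 1)) (-(1 / 2)) * twist Real.pi (1 / 2) := by
      rw [twistMotion, max_eq_right (by linarith), min_eq_left (by linarith), mul_one]
    have hs : 0 ≤ Real.sin (Real.pi * (2 * u - 1)) :=
      Real.sin_nonneg_of_nonneg_of_le_pi (mul_nonneg hpi.le (by linarith)) (by nlinarith)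
    have hsc := Real.sin_sq_add_cos_sq (Real.pi * (2 * u - 1))
    have e1 : twist Real.pi (1 / 2) 1 = 0 := by
      rw [twist_right_one]; apply Complex.ext <;> simp
    have e2 : twist Real.pi (1 / 2) 0 = 1 := by
      rw [twist_right_zero]; apply Complex.ext <;> norm_num
    simp only [e, Homeomorph.mul_apply, e1, e2, twist_right_neg_one, twist_left_neg_one,
      twist_left_one, twist_left_zero]
    generalize Real.sin (Real.pi * (2 * u - 1)) = s at *
    generalize Real.cos (Real.pi * (2 * u - 1)) = c at *
    constructor
    · simp only [Complex.one_re]; nlinarith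
    · simp only; intro h
      have : c = 0 := by linarith
      nlinarith
    · simp only [Complex.one_re]; intro h; nlinarith

/-! ### The rotation of a triangle -/

/-- A vertical shear that maps the punctures to the vertices of an equilateral triangle. -/
def shear : ℂ ≃ₜ ℂ where
  toFun z := ⟨z.re, z.im + √3 * |z.re|⟩
  invFun z := ⟨z.re, z.im - √3 * |z.re|⟩
  left_inv z := by apply Complex.ext <;> simp
  right_inv z := by apply Complex.ext <;> simp
  continuous_toFun := continuous_complex_mk (by fun_prop) (by fun_prop)
  continuous_invFun := continuous_complex_mk (by fun_prop) (by fun_prop)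

/-- The rotation about the point `2 / √3 * I` by the angle `a`. -/
def rotation (a : ℝ) : ℂ ≃ₜ ℂ where
  toFun z := (2 / √3 : ℝ) * Complex.I + Complex.exp (a * Complex.I) * (z - (2 / √3 : ℝ) * Complex.I)
  invFun z :=
    (2 / √3 : ℝ) * Complex.I + Complex.exp (-(a * Complex.I)) * (z - (2 / √3 : ℝ) * Complex.I)
  left_inv z := by
    simp only [add_sub_cancel_left, ← mul_assoc, ← Complex.exp_add]
    simp
  right_inv z := by
    simp only [add_sub_cancel_left, ← mul_assoc, ← Complex.exp_add]
    simp
  continuous_toFun := by fun_prop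
  continuous_invFun := by fun_prop

theorem rotation_zero : rotation 0 = 1 := by
  ext z
  simp [rotation]

theorem rotation_cube : rotation (2 * Real.pi / 3) ^ 3 = 1 := by
  ext z
  simp only [pow_succ, pow_zero, one_mul, Homeomorph.mul_apply]
  simp only [rotation, Homeomorph.homeomorph_mk_coe, Equiv.coe_fn_mk, add_sub_cancel_left,
    ← mul_assoc, ← Complex.exp_add]
  have : ((2 * Real.pi / 3 : ℝ) : ℂ) * Complex.I + (((2 * Real.pi / 3 : ℝ) : ℂ) * Complex.I +
      ((2 * Real.pi / 3 : ℝ) : ℂ) * Complex.I) = 2 * Real.pi * Complex.I := by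
    push_cast; ring
  rw [this, Complex.exp_two_pi_mul_I]
  simp

/-- The isotopy that rotates the triangle formed by the sheared punctures. -/
def rotationMotion (u : unitInterval) : ℂ ≃ₜ ℂ := shear⁻¹ * rotation (2 * Real.pi / 3 * u) * shear

theorem shear_rotation_apply (a : ℝ) (z : ℂ) : (shear⁻¹ * rotation a * shear) z =
    ⟨Real.cos a * z.re - Real.sin a * (z.im + √3 * |z.re| - 2 / √3),
      2 / √3 + Real.sin a * z.re + Real.cos a * (z.im + √3 * |z.re| - 2 / √3) -
        √3 * |Real.cos a * z.re - Real.sin a * (z.im + √3 * |z.re| - 2 / √3)|⟩ := by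
  have : rotation a (shear z) =
      ⟨Real.cos a * z.re - Real.sin a * (z.im + √3 * |z.re| - 2 / √3),
      2 / √3 + Real.sin a * z.re + Real.cos a * (z.im + √3 * |z.re| - 2 / √3)⟩ := by
    change (2 / √3 : ℝ) * Complex.I + Complex.exp (a * Complex.I) * (_ - _) = _
    rw [Complex.exp_mul_I, ← Complex.ofReal_cos, ← Complex.ofReal_sin]
    generalize Real.cos a = c
    generalize Real.sin a = s
    apply Complex.ext <;> simp [shear] <;> ring
  rw [Homeomorph.mul_apply, Homeomorph.mul_apply, this]
  rfl

/-- The inverse shear preserves abscissas and the order on vertical lines, so the rotated triangle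
can be examined instead. With rotation angle a, the horizontal gap between the images of `-1` and
`0` is 2 cos(a - π/3), positive on [0, 2π/3]. -/
theorem rotationMotion_admissible (u : unitInterval) :
    Admissible (rotationMotion u 1) (rotationMotion u (-1)) (rotationMotion u 0) := by
  have hu0 := u.2.1
  have hu1 := u.2.2
  have hpi := Real.pi_pos
  have hs : 0 ≤ Real.sin (2 * Real.pi / 3 * u) :=
    Real.sin_nonneg_of_nonneg_of_le_pi (by positivity) (by nlinarith)
  have hsc := Real.sin_sq_add_cos_sq (2 * Real.pi / 3 * u)
  have hc : 0 < Real.cos (2 * Real.pi / 3 * u - Real.pi / 3) :=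
    Real.cos_pos_of_mem_Ioo ⟨by nlinarith, by nlinarith⟩
  rw [Real.cos_sub, Real.cos_pi_div_three, Real.sin_pi_div_three] at hc
  have h3 : √3 * √3 = 3 := Real.mul_self_sqrt (by norm_num)
  have h3' : 0 < √3 := by positivity
  have hd : 2 / √3 = 2 * √3 / 3 := by field_simp; linarith
  simp only [rotationMotion, shear_rotation_apply, hd]
  generalize Real.sin (2 * Real.pi / 3 * u) = s at *
  generalize Real.cos (2 * Real.pi / 3 * u) = c at *
  generalize √3 = r at *
  constructor
  · simp; nlinarith
  · simp only
    intro h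
    rw [h]
    simp at h ⊢
    have hc0 : c = 0 := by linarith
    have : 0 < s := by
      rcases hs.eq_or_lt with h | h
      · rw [hc0, ← h] at hsc; norm_num at hsc
      · exact h
    subst hc0
    linarith
  · simp only
    intro h
    rw [h]
    simp at h ⊢
    have hc0 : c = r * s := by linarith
    have : 0 < s := by
      rcases hs.eq_or_lt with h | h
      · subst h; subst hc0; norm_num at hsc
      · exact h
    subst hc0
    nlinarith

/-! ### Powers of the full twist -/

theorem Isotopic.pow_of_fixed_images {H : unitInterval → ℂ ≃ₜ ℂ}
    (hH : Continuous fun q : unitInterval × ℂ => H q.1 q.2)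
    (hp : ∀ u, H u '' punctures = punctures) (n : ℕ) : Isotopic (H 0 ^ n) (H 1 ^ n) := by
  refine ⟨fun u => H u ^ n, ?_, rfl, rfl, ?_⟩
  · induction n with
    | zero => exact continuous_snd
    | succ n ih =>
      simp only [pow_succ]
      exact ih.comp (continuous_fst.prodMk hH)
  · intro u
    induction n with
    | zero => exact Set.image_id _
    | succ n ih =>
      have : H u ^ (n + 1) = H u ^ n * H u := pow_succ _ _
      change ⇑(H u ^ (n + 1)) '' punctures = punctures
      rw [this]
      change ((H u ^ n : ℂ ≃ₜ ℂ) ∘ H u) '' punctures = punctures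
      rw [Set.image_comp, hp, ih]

/-- Both motions end with the same permutation 1 ↦ -1 ↦ 0 ↦ 1 of the punctures, so their ends are
isotopic. Powers of an isotopy are isotopies, and the rotation has cube 1. -/
theorem isotopic_twists_pow (j : ℕ) :
    Isotopic ((halfTwist (-(1 / 2)) * halfTwist (1 / 2)) ^ (3 * j)) (Homeomorph.refl ℂ) := by
  have hF1 : twistMotion 1 = halfTwist (-(1 / 2)) * halfTwist (1 / 2) := by
    rw [halfTwist_eq, halfTwist_eq, twistMotion]
    norm_num
  have hk1 : rotationMotion 1 ^ 3 = 1 := by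
    rw [rotationMotion, ← inv_inv shear, inv_inv shear⁻¹, conj_pow, Set.Icc.coe_one, mul_one,
      rotation_cube]
    group
  have hk : ∀ z, rotationMotion 1 z = (shear⁻¹ * rotation (2 * Real.pi / 3) * shear) z := by
    intro z
    rw [rotationMotion, Set.Icc.coe_one, mul_one]
  have e1 : twist Real.pi (1 / 2) 1 = 0 := by
    rw [twist_right_one]; apply Complex.ext <;> simp
  have e2 : twist Real.pi (1 / 2) 0 = 1 := by
    rw [twist_right_zero]; apply Complex.ext <;> norm_num
  have f1 : twistMotion 1 1 = -1 := by
    rw [hF1, halfTwist_eq, halfTwist_eq, Homeomorph.mul_apply, e1, twist_left_zero]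
    apply Complex.ext <;> norm_num
  have f2 : twistMotion 1 (-1) = 0 := by
    rw [hF1, halfTwist_eq, halfTwist_eq, Homeomorph.mul_apply, twist_right_neg_one,
      twist_left_neg_one]
    apply Complex.ext <;> norm_num
  have f3 : twistMotion 1 0 = 1 := by
    rw [hF1, halfTwist_eq, halfTwist_eq, Homeomorph.mul_apply, e2, twist_left_one]
  have hcos : Real.cos (2 * Real.pi / 3) = -1 / 2 := by
    rw [show 2 * Real.pi / 3 = Real.pi - Real.pi / 3 by ring, Real.cos_pi_sub,
      Real.cos_pi_div_three]
    norm_num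
  have hsin : Real.sin (2 * Real.pi / 3) = √3 / 2 := by
    rw [show 2 * Real.pi / 3 = Real.pi - Real.pi / 3 by ring, Real.sin_pi_sub,
      Real.sin_pi_div_three]
  have h3 : √3 * √3 = 3 := Real.mul_self_sqrt (by norm_num)
  have hd : 2 / √3 = 2 * √3 / 3 := by field_simp; linarith
  have g : ∀ x y : ℝ, rotationMotion 1 ⟨x, y⟩ =
      ⟨-1 / 2 * x - √3 / 2 * (y + √3 * |x| - 2 / √3),
      2 / √3 + √3 / 2 * x + -1 / 2 * (y + √3 * |x| - 2 / √3) -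
        √3 * |-1 / 2 * x - √3 / 2 * (y + √3 * |x| - 2 / √3)|⟩ := by
    intro x y
    rw [hk, shear_rotation_apply, hcos, hsin]
  have g1 : rotationMotion 1 1 = -1 := by
    have : -1 / 2 * 1 - √3 / 2 * (0 + √3 * |1| - 2 / √3) = (-1 : ℝ) := by
      rw [hd, abs_one]; linarith
    rw [show (1 : ℂ) = ⟨1, 0⟩ from rfl, g, this]
    apply Complex.ext
    · simp
    · simp [hd]; linarith
  have g2 : rotationMotion 1 (-1) = 0 := by
    have : -1 / 2 * (-1) - √3 / 2 * (0 + √3 * |(-1 : ℝ)| - 2 / √3) = (0 : ℝ) := by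
      rw [hd, abs_neg, abs_one]; linarith
    rw [show (-1 : ℂ) = ⟨-1, 0⟩ from by apply Complex.ext <;> simp, g, this]
    apply Complex.ext
    · simp
    · simp [hd]; linarith
  have g3 : rotationMotion 1 0 = 1 := by
    have : -1 / 2 * 0 - √3 / 2 * (0 + √3 * |(0 : ℝ)| - 2 / √3) = (1 : ℝ) := by
      rw [hd, abs_zero]; linarith
    rw [show (0 : ℂ) = ⟨0, 0⟩ from rfl, g, this]
    apply Complex.ext
    · simp
    · simp [hd]; linarith
  obtain ⟨H, hH, hH0, hH1, hHp⟩ := exists_isotopy_of_admissible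
    (F := twistMotion) (k := rotationMotion) (p₁ := 1) (p₂ := -1) (p₃ := 0)
    (by
      unfold twistMotion
      simp only [Homeomorph.mul_apply]
      exact continuous_twist _ (by fun_prop) (continuous_twist _ (by fun_prop) continuous_snd))
    (by
      unfold twistMotion
      simp only [mul_inv_rev, twist_inv, Homeomorph.mul_apply]
      exact continuous_twist _ (by fun_prop) (continuous_twist _ (by fun_prop) continuous_snd))
    (by
      unfold rotationMotion
      refine (shear⁻¹).continuous.comp ?_
      have : Continuous fun q : unitInterval × ℂ => shear q.2 :=
        shear.continuous.comp continuous_snd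
      change Continuous fun q : unitInterval × ℂ => (2 / √3 : ℝ) * Complex.I +
        Complex.exp ((2 * Real.pi / 3 * (q.1 : ℝ) : ℝ) * Complex.I) *
          (shear q.2 - (2 / √3 : ℝ) * Complex.I)
      fun_prop)
    (by simp [twistMotion, twist_zero])
    (by simp [rotationMotion, rotation_zero])
    twistMotion_admissible rotationMotion_admissible (by rw [f1, g1]) (by rw [f2, g2])
    (by rw [f3, g3])
  have := Isotopic.pow_of_fixed_images hH (fun u => by
    obtain ⟨a1, a2, a3⟩ := hHp u
    rw [punctures, Set.image_insert_eq, Set.image_insert_eq, Set.image_singleton, a1, a2, a3, f1,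
      f2, f3]
    ext z
    simp only [Set.mem_insert_iff, Set.mem_singleton_iff]
    tauto) (3 * j)
  rw [hH0, hH1, hF1, pow_mul (rotationMotion 1), hk1, one_pow] at this
  exact this

theorem isPeriodic_of_cube {w : Braid3} {j : ℕ} (h : w ^ 3 = garside ^ (2 * j)) :
    IsPeriodic w := by
  -- This word represents w³ because (σ₁σ₂)³ = Δ².
  refine ⟨3, by norm_num, (FreeGroup.of 0 * FreeGroup.of 1) ^ (3 * j), ?_, ?_⟩
  · rw [h, map_pow, pow_mul garside, ← sigma_zero_one_cube, ← pow_mul, map_mul]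
    rfl
  · simpa [wordHomeo] using isotopic_twists_pow j

/-! ### Evaluation of the Burau matrices of positive braids -/

theorem evalAt_toLaurent (t : ℂ) (p : Polynomial ℤ) :
    evalAt t (Polynomial.toLaurent p) = p.eval₂ (Int.castRingHom ℂ) t := by
  induction p using Polynomial.induction_on' with
  | add p q hp hq =>
    rw [Polynomial.eval₂_add, ← hp, ← hq, map_add]
    unfold evalAt
    rw [AddMonoidAlgebra.coeff_add]
    exact Finsupp.sum_add_index' (by simp) (by intros; push_cast; ring)
  | monomial n a =>
    rw [Polynomial.toLaurent_C_mul_T, ← single_eq_C_mul_T, Polynomial.eval₂_monomial, evalAt,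
      AddMonoidAlgebra.coeff_single, Finsupp.sum_single_index (by simp)]
    simp

theorem exists_polynomial_burau {w : Braid3} (hw : IsPositive w) :
    ∃ P : Matrix (Fin 2) (Fin 2) (Polynomial ℤ),
      (burau w : Matrix (Fin 2) (Fin 2) ℤ[T;T⁻¹]) = P.map Polynomial.toLaurent := by
  induction hw using Submonoid.closure_induction with
  | mem x hx =>
    obtain ⟨i, rfl⟩ := hx
    fin_cases i
    · refine ⟨!![-Polynomial.X, 1; 0, 1], ?_⟩
      simp only [burau, σ, PresentedGroup.toGroup.of, burauGen]
      ext i j : 2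
      fin_cases i <;> fin_cases j <;> simp
    · refine ⟨!![1, 0; Polynomial.X, -Polynomial.X], ?_⟩
      simp only [burau, σ, PresentedGroup.toGroup.of, burauGen]
      ext i j : 2
      fin_cases i <;> fin_cases j <;> simp
  | one => exact ⟨1, by simp⟩
  | mul x y _ _ hx hy =>
    obtain ⟨P, hP⟩ := hx
    obtain ⟨Q, hQ⟩ := hy
    exact ⟨P * Q, by rw [map_mul, Units.val_mul, hP, hQ, Matrix.map_mul]⟩

/-- The reduced Burau representation at a non-zero complex number. -/
def burauHom (t : ℂˣ) : Braid3 →* Matrix (Fin 2) (Fin 2) ℂ :=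
  ((LaurentPolynomial.eval₂ (Int.castRingHom ℂ) t).mapMatrix.toMonoidHom.comp
    (Units.coeHom _)).comp burau

theorem burauAt_eq_burauHom {w : Braid3} (hw : IsPositive w) (t : ℂˣ) :
    burauAt t w = burauHom t w := by
  obtain ⟨P, hP⟩ := exists_polynomial_burau hw
  change (burau w : Matrix (Fin 2) (Fin 2) ℤ[T;T⁻¹]).map (evalAt t) =
    (burau w : Matrix (Fin 2) (Fin 2) ℤ[T;T⁻¹]).map (LaurentPolynomial.eval₂ (Int.castRingHom ℂ) t)
  rw [hP]
  ext i j
  simp only [Matrix.map_apply, evalAt_toLaurent, LaurentPolynomial.eval₂_toLaurent]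

theorem continuous_burauAt {w : Braid3} (hw : IsPositive w) : Continuous fun t => burauAt t w := by
  obtain ⟨P, hP⟩ := exists_polynomial_burau hw
  refine continuous_matrix fun i j => ?_
  simp only [burauAt, hP, Matrix.map_apply, evalAt_toLaurent]
  exact Polynomial.continuous_eval₂ _ _

theorem burauHom_sigma_zero (t : ℂˣ) : burauHom t (σ 0) = !![-(t : ℂ), 1; 0, 1] := by
  change (burau (σ 0) : Matrix (Fin 2) (Fin 2) ℤ[T;T⁻¹]).map
    (LaurentPolynomial.eval₂ (Int.castRingHom ℂ) t) = _
  simp only [burau, σ, PresentedGroup.toGroup.of, burauGen]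
  ext i j
  fin_cases i <;> fin_cases j <;> simp [LaurentPolynomial.eval₂_T]

theorem burauHom_sigma_one (t : ℂˣ) : burauHom t (σ 1) = !![1, 0; (t : ℂ), -(t : ℂ)] := by
  change (burau (σ 1) : Matrix (Fin 2) (Fin 2) ℤ[T;T⁻¹]).map
    (LaurentPolynomial.eval₂ (Int.castRingHom ℂ) t) = _
  simp only [burau, σ, PresentedGroup.toGroup.of, burauGen]
  ext i j
  fin_cases i <;> fin_cases j <;> simp [LaurentPolynomial.eval₂_T]

/-- The geometric sum `1 + s + ⋯ + s ^ (n - 1)`. -/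
def geom {R : Type*} [CommRing R] (s : R) (n : ℕ) : R := ∑ i ∈ Finset.range n, s ^ i

theorem geom_succ {R : Type*} [CommRing R] (s : R) (n : ℕ) : geom s (n + 1) = geom s n + s ^ n :=
  Finset.sum_range_succ _ _

theorem geom_succ' {R : Type*} [CommRing R] (s : R) (n : ℕ) : geom s (n + 1) = s * geom s n + 1 :=
  geom_sum_succ

/-- The matrix of a block in a basis in which all blocks with exponent at least two have
polynomial entries with non-negative coefficients in `s = -t`. -/
def stepMatrix {R : Type*} [CommRing R] (s : R) (p : ℕ) : Matrix (Fin 2) (Fin 2) R :=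
  !![s * geom s (p - 1), s * geom s (p - 2); 1, 1]

/-- The product of the matrices of blocks. -/
def stepProd {R : Type*} [CommRing R] (s : R) (l : List ℕ) : Matrix (Fin 2) (Fin 2) R :=
  (l.map (stepMatrix s)).prod

/-- The conjugating matrix. -/
def baseChange : Matrix (Fin 2) (Fin 2) ℂ := !![1, -1; 0, 1]

theorem burauHom_sigma_zero_pow (t : ℂˣ) (p : ℕ) :
    burauHom t (σ 0 ^ p) = !![(-(t : ℂ)) ^ p, geom (-(t : ℂ)) p; 0, 1] := by
  induction p with
  | zero => simp [geom, Matrix.one_fin_two]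
  | succ p ih =>
    rw [pow_succ, map_mul, ih, burauHom_sigma_zero, Matrix.mul_fin_two, geom_succ]
    congr 1
    simp [pow_succ, add_comm]

theorem burauHom_garside (t : ℂˣ) : burauHom t garside = !![0, -(t : ℂ); -(t : ℂ) ^ 2, 0] := by
  rw [garside, map_mul, map_mul, burauHom_sigma_zero, burauHom_sigma_one, Matrix.mul_fin_two,
    Matrix.mul_fin_two]
  ext i j
  fin_cases i <;> fin_cases j <;> simp <;> ring

theorem burauHom_garside_pow (t : ℂˣ) (k : ℕ) :
    burauHom t (garside ^ (2 * k)) = ((t : ℂ) ^ (3 * k)) • (1 : Matrix (Fin 2) (Fin 2) ℂ) := by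
  have : burauHom t (garside ^ 2) = ((t : ℂ) ^ 3) • (1 : Matrix (Fin 2) (Fin 2) ℂ) := by
    rw [pow_two, map_mul, burauHom_garside, Matrix.mul_fin_two]
    ext i j
    fin_cases i <;> fin_cases j <;> simp <;> ring
  rw [pow_mul, map_pow, this, smul_pow, one_pow, ← pow_mul]

/-- The bound `2 ≤ p` makes the truncated `p - 2` in `stepMatrix` correct. Multiplying by the matrix
of Δ on the right avoids its inverse. -/
theorem smul_baseChange_mul_block (t : ℂˣ) {p : ℕ} (hp : 2 ≤ p) :
    (-(t : ℂ)) • (baseChange * burauHom t (block p)) = stepMatrix (-(t : ℂ)) p * baseChange := by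
  obtain ⟨q, rfl⟩ := Nat.exists_eq_add_of_le' hp
  have hu : IsUnit (burauHom t garside) := (Group.isUnit garside).map (burauHom t)
  refine hu.mul_right_cancel ?_
  rw [smul_mul_assoc, mul_assoc, ← map_mul, block, inv_mul_cancel_right, burauHom_sigma_zero_pow,
    burauHom_garside, stepMatrix, baseChange, show q + 2 - 1 = q + 1 from rfl,
    show q + 2 - 2 = q from rfl, geom_succ' _ (q + 1), geom_succ]
  simp only [Matrix.mul_fin_two]
  ext i j
  fin_cases i <;> fin_cases j <;> simp <;> ring

theorem smul_baseChange_mul_blockProd (t : ℂˣ) {l : List ℕ} (hl : ∀ p ∈ l, 2 ≤ p) :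
    (-(t : ℂ)) ^ l.length • (baseChange * burauHom t (blockProd l)) =
      stepProd (-(t : ℂ)) l * baseChange := by
  induction l with
  | nil => simp [blockProd, stepProd]
  | cons p l ih =>
    have h1 := smul_baseChange_mul_block t (hl p (by simp))
    have h2 := ih fun q hq => hl q (by simp [hq])
    have h3 : stepProd (-(t : ℂ)) (p :: l) = stepMatrix (-(t : ℂ)) p * stepProd (-(t : ℂ)) l := by
      simp [stepProd]
    rw [blockProd_cons, map_mul, h3, mul_assoc, ← h2, mul_smul_comm, ← mul_assoc, ← mul_assoc, ← h1,
      List.length_cons, pow_succ, mul_smul, smul_mul_assoc]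

/-- The matrix that has, up to sign, the trace and the determinant of the Burau matrix of the normal
form at `t = -s`. -/
def normalMatrix {R : Type*} [CommRing R] (k : ℕ) (l : List ℕ) (s : R) :
    Matrix (Fin 2) (Fin 2) R :=
  s ^ (3 * k - l.length) • stepProd s l

theorem burauHom_normalForm (t : ℂˣ) {k : ℕ} {l : List ℕ} (hl : ∀ p ∈ l, 2 ≤ p)
    (hk : l.length ≤ 2 * k) :
    baseChange * burauHom t (garside ^ (2 * k) * blockProd l) =
      (-1) ^ k • normalMatrix k l (-(t : ℂ)) * baseChange := by
  have ht : (-(t : ℂ)) ^ l.length ≠ 0 := pow_ne_zero _ (neg_ne_zero.2 t.ne_zero)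
  refine smul_right_injective _ ht ?_
  have h := smul_baseChange_mul_blockProd t hl
  simp only
  rw [map_mul, burauHom_garside_pow, smul_mul_assoc, one_mul, mul_smul_comm, smul_comm, h,
    normalMatrix, smul_mul_assoc, smul_mul_assoc, ← smul_comm ((-1 : ℤ) ^ k), smul_smul, ← pow_add,
    show l.length + (3 * k - l.length) = 3 * k by omega, pow_mul, pow_mul,
    show (-(t : ℂ)) ^ 3 = - (t : ℂ) ^ 3 by ring, neg_pow ((t : ℂ) ^ 3)]
  rw [← Int.cast_smul_eq_zsmul ℂ, smul_smul, ← mul_assoc]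
  push_cast
  rw [← mul_pow]
  norm_num

theorem trace_det_burauHom (t : ℂˣ) {w : Braid3} {k : ℕ} {l : List ℕ} (hl : ∀ p ∈ l, 2 ≤ p)
    (hk : l.length ≤ 2 * k) (hw : IsConj w (garside ^ (2 * k) * blockProd l)) :
    (burauHom t w).trace = (-1) ^ k * (normalMatrix k l (-(t : ℂ))).trace ∧
      (burauHom t w).det = (normalMatrix k l (-(t : ℂ))).det := by
  obtain ⟨c, hc⟩ := isConj_iff.1 hw
  have h := burauHom_normalForm t hl hk
  have hcc : burauHom t c⁻¹ * burauHom t c = 1 := by rw [← map_mul, inv_mul_cancel, map_one]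
  have hB : baseChange * !![1, 1; 0, 1] = 1 := by
    rw [baseChange, Matrix.mul_fin_two, Matrix.one_fin_two]; norm_num
  have h' : (-1) ^ k • normalMatrix k l (-(t : ℂ)) =
      baseChange * (burauHom t c * burauHom t w * burauHom t c⁻¹) * !![1, 1; 0, 1] := by
    rw [← map_mul, ← map_mul, hc, h, mul_assoc, hB, mul_one]
  have hsign : ((-1 : ℂ) ^ k) * (-1) ^ k = 1 := by rw [← mul_pow]; norm_num
  constructor
  · have ht := congrArg Matrix.trace h'
    rw [mul_assoc, Matrix.trace_mul_comm, mul_assoc, mul_eq_one_comm.1 hB, mul_one, mul_assoc,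
      Matrix.trace_mul_comm, mul_assoc, hcc, mul_one, ← Int.cast_smul_eq_zsmul ℂ,
      Matrix.trace_smul, smul_eq_mul] at ht
    rw [← ht]
    push_cast
    rfl
  · have hd := congrArg Matrix.det h'
    have hB' := congrArg Matrix.det hB
    have hcc' := congrArg Matrix.det hcc
    rw [Matrix.det_mul, Matrix.det_one] at hB' hcc'
    rw [← Int.cast_smul_eq_zsmul ℂ, Matrix.det_smul, Matrix.det_mul, Matrix.det_mul, Matrix.det_mul,
      Matrix.det_mul, Fintype.card_fin] at hd
    push_cast at hd
    rw [pow_two, hsign, one_mul] at hd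
    rw [hd]
    linear_combination (-(burauHom t w).det * (burauHom t c⁻¹).det * (burauHom t c).det) * hB' -
      (burauHom t w).det * hcc'

theorem continuous_normalMatrix (k : ℕ) (l : List ℕ) :
    Continuous fun s : ℂ => normalMatrix k l s := by
  refine (continuous_pow _).smul ?_
  induction l with
  | nil => exact continuous_const
  | cons p l ih =>
    have : (fun s : ℂ => stepProd s (p :: l)) = fun s => stepMatrix s p * stepProd s l := by
      funext s; simp [stepProd]
    rw [this]
    refine Continuous.matrix_mul (continuous_matrix fun i j => ?_) ih
    fin_cases i <;> fin_cases j <;> simp [stepMatrix, geom] <;> fun_prop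

/-- The normal form involves Δ⁻¹ and is available only for t ≠ 0; both sides are continuous in t, so
the identities extend to t = 0 by density. -/
theorem trace_det_burauAt {w : Braid3} (hpos : IsPositive w) {k : ℕ} {l : List ℕ}
    (hl : ∀ p ∈ l, 2 ≤ p) (hk : l.length ≤ 2 * k)
    (hw : IsConj w (garside ^ (2 * k) * blockProd l)) (t : ℂ) :
    (burauAt t w).trace = (-1) ^ k * (normalMatrix k l (-t)).trace ∧
      (burauAt t w).det = (normalMatrix k l (-t)).det := by
  have hc := continuous_burauAt hpos
  have hc' := (continuous_normalMatrix k l).comp continuous_neg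
  have hd : Dense ({0}ᶜ : Set ℂ) := dense_compl_singleton 0
  have h : ∀ t ∈ ({0}ᶜ : Set ℂ), (burauAt t w).trace = (-1) ^ k * (normalMatrix k l (-t)).trace ∧
      (burauAt t w).det = (normalMatrix k l (-t)).det := by
    intro t ht
    have := trace_det_burauHom (Units.mk0 t ht) hl hk hw
    rwa [← burauAt_eq_burauHom hpos] at this
  constructor
  · exact congrFun (Continuous.ext_on hd hc.matrix_trace (continuous_const.mul hc'.matrix_trace)
      fun t ht => (h t ht).1) t
  · exact congrFun (Continuous.ext_on hd hc.matrix_det hc'.matrix_det fun t ht => (h t ht).2) t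

/-! ### Spectral radii of two by two matrices -/

theorem mem_spectrum_fin_two {M : Matrix (Fin 2) (Fin 2) ℂ} {z : ℂ} :
    z ∈ spectrum ℂ M ↔ z ^ 2 - M.trace * z + M.det = 0 := by
  rw [Matrix.mem_spectrum_iff_isRoot_charpoly, Matrix.charpoly_fin_two]
  simp

/-- The map z ↦ (-1)^k z sends eigenvalues of `M` to eigenvalues of `N` and preserves absolute
values. -/
theorem spectralRadius_le_of_trace_det {M N : Matrix (Fin 2) (Fin 2) ℂ} {k : ℕ}
    (ht : M.trace = (-1) ^ k * N.trace) (hd : M.det = N.det) :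
    spectralRadius ℂ M ≤ spectralRadius ℂ N := by
  refine iSup₂_le fun z hz => ?_
  have hn : ‖z‖₊ = ‖(-1) ^ k * z‖₊ := by simp
  rw [hn]
  refine le_iSup₂ (f := fun (z : ℂ) (_ : z ∈ spectrum ℂ N) => (‖z‖₊ : ENNReal)) ((-1) ^ k * z) ?_
  rw [mem_spectrum_fin_two] at hz ⊢
  have hsign : ((-1 : ℂ) ^ k) * (-1) ^ k = 1 := by rw [← mul_pow]; norm_num
  rw [ht, hd] at hz
  linear_combination hz + z ^ 2 * hsign

theorem rho_eq {w : Braid3} (hpos : IsPositive w) {k : ℕ} {l : List ℕ}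
    (hl : ∀ p ∈ l, 2 ≤ p) (hk : l.length ≤ 2 * k)
    (hw : IsConj w (garside ^ (2 * k) * blockProd l)) (t : ℂ) :
    rho w t = (spectralRadius ℂ (normalMatrix k l (-t))).toReal := by
  obtain ⟨ht, hd⟩ := trace_det_burauAt hpos hl hk hw t
  have hsign : ((-1 : ℂ) ^ k) * (-1) ^ k = 1 := by rw [← mul_pow]; norm_num
  rw [rho, le_antisymm (spectralRadius_le_of_trace_det ht hd)
    (spectralRadius_le_of_trace_det (k := k) (by rw [ht, ← mul_assoc, hsign, one_mul]) hd.symm)]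

/-- The larger eigenvalue of a two by two matrix with non-negative entries. -/
def perron (M : Matrix (Fin 2) (Fin 2) ℝ) : ℝ :=
  (M 0 0 + M 1 1 + √((M 0 0 - M 1 1) ^ 2 + 4 * (M 0 1 * M 1 0))) / 2

theorem spectralRadius_eq_perron {M : Matrix (Fin 2) (Fin 2) ℝ} (hM : ∀ i j, 0 ≤ M i j) :
    (spectralRadius ℂ (M.map Complex.ofReal)).toReal = perron M := by
  set r := √((M 0 0 - M 1 1) ^ 2 + 4 * (M 0 1 * M 1 0)) with hr
  have hr0 : 0 ≤ r := Real.sqrt_nonneg _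
  have hr2 : r ^ 2 = (M 0 0 - M 1 1) ^ 2 + 4 * (M 0 1 * M 1 0) :=
    Real.sq_sqrt (add_nonneg (sq_nonneg _)
      (mul_nonneg (by norm_num) (mul_nonneg (hM 0 1) (hM 1 0))))
  have h0 := hM 0 0
  have h1 := hM 1 1
  have hp : perron M = (M 0 0 + M 1 1 + r) / 2 := rfl
  have hp0 : 0 ≤ perron M := by rw [hp]; linarith
  have hfac : ∀ z : ℂ, z ^ 2 - (M.map Complex.ofReal).trace * z + (M.map Complex.ofReal).det =
      (z - (perron M : ℝ)) * (z - ((M 0 0 + M 1 1 - r) / 2 : ℝ)) := by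
    intro z
    have hr2' : (r : ℂ) ^ 2 = (M 0 0 - M 1 1) ^ 2 + 4 * (M 0 1 * M 1 0) := by exact_mod_cast hr2
    rw [Matrix.trace_fin_two, Matrix.det_fin_two, hp]
    simp only [Matrix.map_apply]
    push_cast
    linear_combination (1 / 4) * hr2'
  have hn : ∀ z : ℂ, (‖z‖₊ : ENNReal) = ENNReal.ofReal ‖z‖ := fun z => by
    rw [← coe_nnnorm, ENNReal.ofReal_coe_nnreal]
  have : spectralRadius ℂ (M.map Complex.ofReal) = ENNReal.ofReal (perron M) := by
    apply le_antisymm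
    · refine iSup₂_le fun z hz => ?_
      rw [mem_spectrum_fin_two, hfac, mul_eq_zero, sub_eq_zero, sub_eq_zero] at hz
      rw [hn]
      apply ENNReal.ofReal_le_ofReal
      rcases hz with rfl | rfl
      · rw [Complex.norm_real, Real.norm_of_nonneg hp0]
      · rw [Complex.norm_real, Real.norm_eq_abs, abs_le, hp]
        constructor <;> linarith
    · have hz : ((perron M : ℝ) : ℂ) ∈ spectrum ℂ (M.map Complex.ofReal) := by
        rw [mem_spectrum_fin_two, hfac, sub_self, zero_mul]
      refine le_trans (le_of_eq ?_) (le_iSup₂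
        (f := fun (z : ℂ) (_ : z ∈ spectrum ℂ (M.map Complex.ofReal)) => (‖z‖₊ : ENNReal)) _ hz)
      rw [hn, Complex.norm_real, Real.norm_of_nonneg hp0]
  rw [this, ENNReal.toReal_ofReal hp0]

/-! ### Monotonicity of the Perron eigenvalue -/

theorem perron_sq {M : Matrix (Fin 2) (Fin 2) ℝ} (hM : ∀ i j, 0 ≤ M i j) :
    √((M 0 0 - M 1 1) ^ 2 + 4 * (M 0 1 * M 1 0)) ^ 2 =
      (M 0 0 - M 1 1) ^ 2 + 4 * (M 0 1 * M 1 0) :=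
  Real.sq_sqrt (add_nonneg (sq_nonneg _)
    (mul_nonneg (by norm_num) (mul_nonneg (hM 0 1) (hM 1 0))))

/-- The hypotheses say that `c` lies to the right of both diagonal entries and that the
characteristic polynomial is non-negative there. -/
theorem perron_le {M : Matrix (Fin 2) (Fin 2) ℝ} {c : ℝ} (h0 : M 0 0 ≤ c) (h1 : M 1 1 ≤ c)
    (h : M 0 1 * M 1 0 ≤ (c - M 0 0) * (c - M 1 1)) : perron M ≤ c := by
  have : √((M 0 0 - M 1 1) ^ 2 + 4 * (M 0 1 * M 1 0)) ≤ 2 * c - M 0 0 - M 1 1 :=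
    Real.sqrt_le_iff.2 ⟨by linarith, by nlinarith⟩
  rw [perron]
  linarith

theorem perron_lt {M : Matrix (Fin 2) (Fin 2) ℝ} {c : ℝ} (h0 : M 0 0 < c) (h1 : M 1 1 < c)
    (h : M 0 1 * M 1 0 < (c - M 0 0) * (c - M 1 1)) : perron M < c := by
  have : √((M 0 0 - M 1 1) ^ 2 + 4 * (M 0 1 * M 1 0)) < 2 * c - M 0 0 - M 1 1 :=
    (Real.sqrt_lt' (by linarith)).2 (by nlinarith)
  rw [perron]
  linarith

/-- The characteristic polynomial of `N` vanishes at its Perron eigenvalue; passing to the smaller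
entries of `M` makes the value there positive. -/
theorem perron_lt_perron {M N : Matrix (Fin 2) (Fin 2) ℝ} (hM : ∀ i j, 0 ≤ M i j)
    (hMN : ∀ i j, M i j < N i j) : perron M < perron N := by
  have hN : ∀ i j, 0 ≤ N i j := fun i j => (hM i j).trans (hMN i j).le
  have hsq := perron_sq hN
  have hbc := mul_nonneg (hN 0 1) (hN 1 0)
  have hr : |N 0 0 - N 1 1| ≤ √((N 0 0 - N 1 1) ^ 2 + 4 * (N 0 1 * N 1 0)) :=
    Real.abs_le_sqrt (by linarith)
  obtain ⟨hr1, hr2⟩ := abs_le.1 hr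
  have hp : perron N = (N 0 0 + N 1 1 + √((N 0 0 - N 1 1) ^ 2 + 4 * (N 0 1 * N 1 0))) / 2 := rfl
  generalize √((N 0 0 - N 1 1) ^ 2 + 4 * (N 0 1 * N 1 0)) = r at *
  have h0 : N 0 0 ≤ perron N := by rw [hp]; linarith
  have h1 : N 1 1 ≤ perron N := by rw [hp]; linarith
  have hprod : N 0 1 * N 1 0 = (perron N - N 0 0) * (perron N - N 1 1) := by
    rw [hp]; linear_combination (-1 / 4) * hsq
  refine perron_lt ((hMN 0 0).trans_le h0) ((hMN 1 1).trans_le h1) ?_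
  calc M 0 1 * M 1 0 < N 0 1 * N 1 0 :=
        mul_lt_mul'' (hMN 0 1) (hMN 1 0) (hM 0 1) (hM 1 0)
    _ = (perron N - N 0 0) * (perron N - N 1 1) := hprod
    _ ≤ (perron N - M 0 0) * (perron N - M 1 1) := by
        have := hMN 0 0
        have := hMN 1 1
        apply mul_le_mul <;> linarith

/-! ### Positivity and monotonicity of the normal form -/

theorem stepProd_cons {R : Type*} [CommRing R] (s : R) (p : ℕ) (l : List ℕ) :
    stepProd s (p :: l) = stepMatrix s p * stepProd s l := by
  simp [stepProd]

theorem stepProd_append {R : Type*} [CommRing R] (s : R) (l l' : List ℕ) :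
    stepProd s (l ++ l') = stepProd s l * stepProd s l' := by
  simp [stepProd]

theorem geom_nonneg {s : ℝ} (hs : 0 ≤ s) (n : ℕ) : 0 ≤ geom s n :=
  Finset.sum_nonneg fun _ _ => pow_nonneg hs _

theorem geom_mono {s s' : ℝ} (hs : 0 ≤ s) (h : s ≤ s') (n : ℕ) : geom s n ≤ geom s' n :=
  Finset.sum_le_sum fun _ _ => pow_le_pow_left₀ hs h _

theorem geom_pos {s : ℝ} (hs : 0 ≤ s) (n : ℕ) : 0 < geom s (n + 1) := by
  rw [geom_succ']
  have := mul_nonneg hs (geom_nonneg hs n)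
  linarith

theorem stepMatrix_nonneg {s : ℝ} (hs : 0 ≤ s) (p : ℕ) (i j : Fin 2) : 0 ≤ stepMatrix s p i j := by
  have h1 := mul_nonneg hs (geom_nonneg hs (p - 1))
  have h2 := mul_nonneg hs (geom_nonneg hs (p - 2))
  fin_cases i <;> fin_cases j <;> simp [stepMatrix, h1, h2]

theorem stepMatrix_mono {s s' : ℝ} (hs : 0 ≤ s) (h : s ≤ s') (p : ℕ) (i j : Fin 2) :
    stepMatrix s p i j ≤ stepMatrix s' p i j := by
  have h1 := mul_le_mul h (geom_mono hs h (p - 1)) (geom_nonneg hs _) (hs.trans h)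
  have h2 := mul_le_mul h (geom_mono hs h (p - 2)) (geom_nonneg hs _) (hs.trans h)
  fin_cases i <;> fin_cases j <;> simp [stepMatrix, h1, h2]

theorem mul_entry_nonneg {M N : Matrix (Fin 2) (Fin 2) ℝ} (hM : ∀ i j, 0 ≤ M i j)
    (hN : ∀ i j, 0 ≤ N i j) (i j : Fin 2) : 0 ≤ (M * N) i j := by
  rw [Matrix.mul_apply]
  exact Finset.sum_nonneg fun k _ => mul_nonneg (hM i k) (hN k j)

theorem le_mul_entry {M N : Matrix (Fin 2) (Fin 2) ℝ} (hM : ∀ i j, 0 ≤ M i j)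
    (hN : ∀ i j, 0 ≤ N i j) (i k j : Fin 2) : M i k * N k j ≤ (M * N) i j := by
  rw [Matrix.mul_apply]
  exact Finset.single_le_sum (f := fun k => M i k * N k j)
    (fun k _ => mul_nonneg (hM i k) (hN k j)) (Finset.mem_univ k)

theorem stepProd_nonneg {s : ℝ} (hs : 0 ≤ s) (l : List ℕ) (i j : Fin 2) :
    0 ≤ stepProd s l i j := by
  induction l generalizing i j with
  | nil => fin_cases i <;> fin_cases j <;> simp [stepProd]
  | cons p l ih =>
    rw [stepProd_cons]
    exact mul_entry_nonneg (stepMatrix_nonneg hs p) ih i j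

theorem stepProd_mono {s s' : ℝ} (hs : 0 ≤ s) (h : s ≤ s') (l : List ℕ) (i j : Fin 2) :
    stepProd s l i j ≤ stepProd s' l i j := by
  induction l generalizing i j with
  | nil => exact le_rfl
  | cons p l ih =>
    rw [stepProd_cons, stepProd_cons, Matrix.mul_apply, Matrix.mul_apply]
    exact Finset.sum_le_sum fun k _ => mul_le_mul (stepMatrix_mono hs h p i k) (ih k j)
      (stepProd_nonneg hs l k j) (stepMatrix_nonneg (hs.trans h) p i k)

theorem stepProd_diag_pos {s : ℝ} (hs : 0 < s) {l : List ℕ} (hl : ∀ p ∈ l, 2 ≤ p) (i : Fin 2) :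
    0 < stepProd s l i i := by
  induction l with
  | nil => simp [stepProd]
  | cons p l ih =>
    rw [stepProd_cons]
    refine lt_of_lt_of_le (mul_pos ?_ (ih fun q hq => hl q (by simp [hq])))
      (le_mul_entry (stepMatrix_nonneg hs.le p) (stepProd_nonneg hs.le l) i i i)
    obtain ⟨q, rfl⟩ := Nat.exists_eq_add_of_le' (hl p (by simp))
    have := mul_pos hs (geom_pos hs.le q)
    fin_cases i
    · simpa [stepMatrix] using this
    · simp [stepMatrix]

/-- A factor of exponent at least 3 has only positive entries (for exponent 2 one entry is 0), and
multiplying by non-negative matrices with positive diagonal keeps them positive. -/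
theorem stepProd_pos {s : ℝ} (hs : 0 < s) {l : List ℕ} (hl : ∀ p ∈ l, 2 ≤ p)
    (h : ∃ p ∈ l, 3 ≤ p) (i j : Fin 2) : 0 < stepProd s l i j := by
  obtain ⟨p, hp, hp3⟩ := h
  obtain ⟨l₁, l₂, rfl⟩ := List.append_of_mem hp
  obtain ⟨q, rfl⟩ := Nat.exists_eq_add_of_le' hp3
  have h1 := mul_pos hs (geom_pos hs.le q)
  have h2 := mul_pos hs (geom_pos hs.le (q + 1))
  have hE : ∀ i j, 0 < stepMatrix s (q + 3) i j := by
    intro i j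
    fin_cases i <;> fin_cases j <;> simp [stepMatrix, h1, h2]
  have hEY : ∀ i j, 0 < (stepMatrix s (q + 3) * stepProd s l₂) i j := fun i j =>
    lt_of_lt_of_le (mul_pos (hE i j) (stepProd_diag_pos hs (fun p hp => hl p (by simp [hp])) j))
      (le_mul_entry (fun i j => (hE i j).le) (stepProd_nonneg hs.le l₂) i j j)
  rw [stepProd_append, stepProd_cons]
  exact lt_of_lt_of_le (mul_pos (stepProd_diag_pos hs (fun p hp => hl p (by simp [hp])) i)
    (hEY i j)) (le_mul_entry (stepProd_nonneg hs.le l₁) (fun i j => (hEY i j).le) i i j)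

section

variable {k : ℕ} {l : List ℕ}

theorem normalMatrix_nonneg {s : ℝ} (hs : 0 ≤ s) (i j : Fin 2) : 0 ≤ normalMatrix k l s i j :=
  mul_nonneg (pow_nonneg hs _) (stepProd_nonneg hs l i j)

/-- Strictness comes from the scalar power of s, whose exponent is positive; the product itself need
only be weakly monotone. -/
theorem normalMatrix_lt {s s' : ℝ} (hs : 0 ≤ s) (h : s < s') (hk : l.length < 3 * k)
    (hl : ∀ p ∈ l, 2 ≤ p) (h3 : ∃ p ∈ l, 3 ≤ p) (i j : Fin 2) :
    normalMatrix k l s i j < normalMatrix k l s' i j := by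
  calc s ^ (3 * k - l.length) * stepProd s l i j
      ≤ s ^ (3 * k - l.length) * stepProd s' l i j := by
        gcongr
        exact stepProd_mono hs h.le l i j
    _ < s' ^ (3 * k - l.length) * stepProd s' l i j := by
        gcongr
        · exact stepProd_pos (hs.trans_lt h) hl h3 i j
        · omega

theorem normalMatrix_pos {s : ℝ} (hs : 0 < s) (hl : ∀ p ∈ l, 2 ≤ p) (h3 : ∃ p ∈ l, 3 ≤ p)
    (i j : Fin 2) : 0 < normalMatrix k l s i j :=
  mul_pos (pow_pos hs _) (stepProd_pos hs hl h3 i j)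

theorem perron_normalMatrix_strictMonoOn (hk : l.length < 3 * k)
    (hl : ∀ p ∈ l, 2 ≤ p) (h3 : ∃ p ∈ l, 3 ≤ p) :
    StrictMonoOn (fun s : ℝ => perron (normalMatrix k l s)) (Set.Ici 0) := fun _ hs _ _ h =>
  perron_lt_perron (normalMatrix_nonneg hs) (normalMatrix_lt hs h hk hl h3)

theorem det_stepProd_one (hl : ∀ p ∈ l, 2 ≤ p) : (stepProd (1 : ℝ) l).det = 1 := by
  induction l with
  | nil => simp [stepProd]
  | cons p l ih =>
    obtain ⟨q, rfl⟩ := Nat.exists_eq_add_of_le' (hl p (by simp))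
    rw [stepProd_cons, Matrix.det_mul, ih fun q hq => hl q (by simp [hq]), mul_one, stepMatrix,
      Matrix.det_fin_two_of, show q + 2 - 1 = q + 1 from rfl, geom_succ]
    simp

/-- Determinant 1 and positive off-diagonal entries make the product of the diagonal entries exceed
1, so the trace exceeds 2. -/
theorem one_lt_perron_normalMatrix_one (hl : ∀ p ∈ l, 2 ≤ p) (h3 : ∃ p ∈ l, 3 ≤ p) :
    1 < perron (normalMatrix k l (1 : ℝ)) := by
  have hN : normalMatrix k l (1 : ℝ) = stepProd 1 l := by simp [normalMatrix]
  have hd := det_stepProd_one hl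
  have hpos := stepProd_pos one_pos hl h3
  rw [Matrix.det_fin_two] at hd
  rw [hN, perron]
  have hr := Real.sqrt_nonneg ((stepProd (1 : ℝ) l 0 0 - stepProd 1 l 1 1) ^ 2 +
    4 * (stepProd 1 l 0 1 * stepProd 1 l 1 0))
  have h1 := mul_pos (hpos 0 1) (hpos 1 0)
  have h2 : 2 < stepProd (1 : ℝ) l 0 0 + stepProd 1 l 1 1 := by
    nlinarith [hpos 0 0, hpos 1 1, sq_nonneg (stepProd (1 : ℝ) l 0 0 - stepProd 1 l 1 1)]
  linarith

/-- The infinite series is q²/(1 - q²) = q²/q = q. -/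
theorem mul_geom_le {q : ℝ} (hq : 0 < q) (h : q ^ 2 + q = 1) (n : ℕ) :
    q ^ 2 * geom (q ^ 2) n ≤ q := by
  have h1 : geom (q ^ 2) n * (q ^ 2 - 1) = (q ^ 2) ^ n - 1 := geom_sum_mul _ _
  have h2 : 0 ≤ (q ^ 2) ^ n := by positivity
  have h3 : geom (q ^ 2) n * q ≤ 1 := by
    rw [show q ^ 2 - 1 = -q by linarith] at h1
    linarith
  nlinarith

/-- A Collatz-Wielandt bound for the vector `(q, 1)`, where `q² + q = 1`. -/
theorem stepProd_mulVec_le {q : ℝ} (hq : 0 < q) (h : q ^ 2 + q = 1) (l : List ℕ) :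
    q ^ l.length * (stepProd (q ^ 2) l 0 0 * q + stepProd (q ^ 2) l 0 1) ≤ q ∧
      q ^ l.length * (stepProd (q ^ 2) l 1 0 * q + stepProd (q ^ 2) l 1 1) ≤ 1 := by
  induction l with
  | nil => simp [stepProd]
  | cons p l ih =>
    obtain ⟨ih0, ih1⟩ := ih
    have h1 := mul_geom_le hq h (p - 1)
    have h2 := mul_geom_le hq h (p - 2)
    have h1' := mul_nonneg (sq_nonneg q) (geom_nonneg (sq_nonneg q) (p - 1))
    have h2' := mul_nonneg (sq_nonneg q) (geom_nonneg (sq_nonneg q) (p - 2))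
    have hn := stepProd_nonneg (sq_nonneg q) l
    have hqn : 0 ≤ q ^ l.length := by positivity
    have hx := mul_nonneg hqn (add_nonneg (mul_nonneg (hn 0 0) hq.le) (hn 0 1))
    have hy := mul_nonneg hqn (add_nonneg (mul_nonneg (hn 1 0) hq.le) (hn 1 1))
    simp only [stepProd_cons, Matrix.mul_apply, Fin.sum_univ_two, stepMatrix, Matrix.of_apply,
      Matrix.cons_val_zero, Matrix.cons_val_one, List.length_cons]
    generalize q ^ 2 * geom (q ^ 2) (p - 1) = a at *
    generalize q ^ 2 * geom (q ^ 2) (p - 2) = b at *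
    set x := q ^ l.length * (stepProd (q ^ 2) l 0 0 * q + stepProd (q ^ 2) l 0 1) with hxd
    set y := q ^ l.length * (stepProd (q ^ 2) l 1 0 * q + stepProd (q ^ 2) l 1 1) with hyd
    have e : x + y ≤ q + 1 := add_le_add ih0 ih1
    have e1 : a * x ≤ q * x := mul_le_mul_of_nonneg_right h1 hx
    have e2 : b * y ≤ q * y := mul_le_mul_of_nonneg_right h2 hy
    constructor
    · calc _ = q * (a * x + b * y) := by rw [hxd, hyd]; ring
        _ ≤ q * (q * (q + 1)) := by
          gcongr
          nlinarith
        _ = q := by linear_combination q * h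
    · calc _ = q * (x + y) := by rw [hxd, hyd]; ring
        _ ≤ q * (q + 1) := by gcongr
        _ = 1 := by linear_combination h

theorem perron_normalMatrix_le_one {q : ℝ} (hq : 0 < q) (h : q ^ 2 + q = 1)
    (hk : l.length ≤ 2 * k) : perron (normalMatrix k l (q ^ 2)) ≤ 1 := by
  obtain ⟨h0, h1⟩ := stepProd_mulVec_le hq h l
  have hn := stepProd_nonneg (sq_nonneg q) l
  -- The exponents compare as 2(3k - n) ≥ n, which is exactly the bound n ≤ 2k on the number of
  -- blocks.
  have hle : (q ^ 2) ^ (3 * k - l.length) ≤ q ^ l.length := by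
    rw [← pow_mul]
    exact pow_le_pow_of_le_one hq.le (by nlinarith) (by omega)
  have hb0 := mul_le_mul_of_nonneg_right hle (add_nonneg (mul_nonneg (hn 0 0) hq.le) (hn 0 1))
  have hb1 := mul_le_mul_of_nonneg_right hle (add_nonneg (mul_nonneg (hn 1 0) hq.le) (hn 1 1))
  have hN := normalMatrix_nonneg (k := k) (l := l) (sq_nonneg q)
  have g0 : normalMatrix k l (q ^ 2) 0 0 * q + normalMatrix k l (q ^ 2) 0 1 ≤ q := by
    simp only [normalMatrix, Matrix.smul_apply, smul_eq_mul]
    linarith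
  have g1 : normalMatrix k l (q ^ 2) 1 0 * q + normalMatrix k l (q ^ 2) 1 1 ≤ 1 := by
    simp only [normalMatrix, Matrix.smul_apply, smul_eq_mul]
    linarith
  generalize normalMatrix k l (q ^ 2) = M at *
  have e0 := hN 0 1
  have e1 := mul_nonneg (hN 1 0) hq.le
  have f0 : M 0 0 ≤ 1 := by
    by_contra! hc
    nlinarith
  refine perron_le f0 (by linarith) ?_
  -- Multiplying the two rows of M(q, 1) ≤ (q, 1) shows that the characteristic polynomial is
  -- non-negative at 1.
  have : M 0 1 * (M 1 0 * q) ≤ (1 - M 0 0) * q * (1 - M 1 1) :=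
    mul_le_mul (by linarith) (by linarith) e1 (mul_nonneg (by linarith) hq.le)
  nlinarith

/-! ### Analyticity -/

theorem contDiff_stepProd (l : List ℕ) (i j : Fin 2) :
    ContDiff ℝ ⊤ fun s : ℝ => stepProd s l i j := by
  have hg : ∀ n, ContDiff ℝ ⊤ fun s : ℝ => geom s n := fun n => by
    unfold geom
    fun_prop
  induction l generalizing i j with
  | nil => exact contDiff_const
  | cons p l ih =>
    simp only [stepProd_cons, Matrix.mul_apply]
    refine ContDiff.sum fun k _ => ContDiff.mul ?_ (ih k j)
    fin_cases i <;> fin_cases k <;> simp only [stepMatrix, Fin.mk_one, Fin.zero_eta, Fin.isValue,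
      Matrix.of_apply, Matrix.cons_val', Matrix.cons_val_zero, Matrix.cons_val_one,
      Matrix.cons_val_fin_one]
    · exact contDiff_id.mul (hg _)
    · exact contDiff_id.mul (hg _)
    · exact contDiff_const
    · exact contDiff_const

/-- The radicand is at least four times the product of the off-diagonal entries, hence positive, so
the square root is analytic there. -/
theorem analyticAt_perron {s : ℝ} (hs : 0 < s) (hl : ∀ p ∈ l, 2 ≤ p) (h3 : ∃ p ∈ l, 3 ≤ p) :
    AnalyticAt ℝ (fun s : ℝ => perron (normalMatrix k l s)) s := by
  have hN : ∀ i j, ContDiffAt ℝ ⊤ (fun s : ℝ => normalMatrix k l s i j) s := fun i j =>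
    ((contDiff_id.pow _).mul (contDiff_stepProd l i j)).contDiffAt
  have hpos := normalMatrix_pos (k := k) hs hl h3
  refine ContDiffAt.analyticAt ?_
  refine ContDiffAt.div_const (((hN 0 0).add (hN 1 1)).add (ContDiffAt.sqrt
    ((((hN 0 0).sub (hN 1 1)).pow 2).add (contDiffAt_const.mul ((hN 0 1).mul (hN 1 0)))) ?_)) 2
  have := mul_pos (hpos 0 1) (hpos 1 0)
  positivity

/-! ### Positive values of the parameter -/

/-- A norm on `ℂ²` that is not increased by the matrices of blocks at `s ∈ [-1, 0]`. -/
def hexNorm (v : Fin 2 → ℂ) : ℝ := max ‖v 0‖ (max ‖v 1‖ ‖v 0 + v 1‖)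

/-- The vector is |a - b| times `v 0` or `v 1` plus min(a, b) times `v 0 + v 1`; the weights sum to
max(a, b) ≤ 1. -/
theorem norm_combination_le (v : Fin 2 → ℂ) {a b : ℝ} (ha : 0 ≤ a) (ha' : a ≤ 1) (hb : 0 ≤ b)
    (hb' : b ≤ 1) : ‖(a : ℂ) * v 0 + (b : ℂ) * v 1‖ ≤ hexNorm v := by
  have h0 : ‖v 0‖ ≤ hexNorm v := le_max_left _ _
  have h1 : ‖v 1‖ ≤ hexNorm v := (le_max_left _ _).trans (le_max_right _ _)
  have h2 : ‖v 0 + v 1‖ ≤ hexNorm v := (le_max_right _ _).trans (le_max_right _ _)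
  have hn : 0 ≤ hexNorm v := (norm_nonneg _).trans h0
  rcases le_total b a with h | h
  · calc ‖(a : ℂ) * v 0 + (b : ℂ) * v 1‖
        = ‖((a - b : ℝ) : ℂ) * v 0 + (b : ℂ) * (v 0 + v 1)‖ := by
          congr 1; push_cast; ring
      _ ≤ (a - b) * ‖v 0‖ + b * ‖v 0 + v 1‖ := by
          refine (norm_add_le _ _).trans_eq ?_
          rw [norm_mul, norm_mul, Complex.norm_of_nonneg (sub_nonneg.2 h),
            Complex.norm_of_nonneg hb]
      _ ≤ (a - b) * hexNorm v + b * hexNorm v := by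
          have := sub_nonneg.2 h
          gcongr
      _ ≤ hexNorm v := by nlinarith
  · calc ‖(a : ℂ) * v 0 + (b : ℂ) * v 1‖
        = ‖((b - a : ℝ) : ℂ) * v 1 + (a : ℂ) * (v 0 + v 1)‖ := by
          congr 1; push_cast; ring
      _ ≤ (b - a) * ‖v 1‖ + a * ‖v 0 + v 1‖ := by
          refine (norm_add_le _ _).trans_eq ?_
          rw [norm_mul, norm_mul, Complex.norm_of_nonneg (sub_nonneg.2 h),
            Complex.norm_of_nonneg ha]
      _ ≤ (b - a) * hexNorm v + a * hexNorm v := by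
          have := sub_nonneg.2 h
          gcongr
      _ ≤ hexNorm v := by nlinarith

theorem geom_neg_mem {t : ℝ} (ht : 0 ≤ t) (ht' : t ≤ 1) (n : ℕ) :
    0 ≤ geom (-t) n ∧ geom (-t) n ≤ 1 := by
  induction n with
  | zero => simp [geom]
  | succ n ih =>
    rw [geom_succ']
    constructor <;> nlinarith [ih.1, ih.2]

/-- With a, b in [0, 1], the new coordinates are -(a v₀ + b v₁) and v₀ + v₁, and their sum is (1 -
a) v₀ + (1 - b) v₁. All three are combinations covered by `norm_combination_le`. -/
theorem hexNorm_stepMatrix_le {t : ℝ} (ht : 0 ≤ t) (ht' : t ≤ 1) (p : ℕ) (v : Fin 2 → ℂ) :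
    hexNorm ((stepMatrix (-(t : ℂ)) p).mulVec v) ≤ hexNorm v := by
  have hg : ∀ n, 0 ≤ t * geom (-t) n ∧ t * geom (-t) n ≤ 1 := fun n =>
    ⟨mul_nonneg ht (geom_neg_mem ht ht' n).1,
      mul_le_one₀ ht' (geom_neg_mem ht ht' n).1 (geom_neg_mem ht ht' n).2⟩
  have hc : ∀ n, -(t : ℂ) * geom (-(t : ℂ)) n = -((t * geom (-t) n : ℝ) : ℂ) := fun n => by
    simp [geom]
  obtain ⟨a0, a1⟩ := hg (p - 1)
  obtain ⟨b0, b1⟩ := hg (p - 2)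
  have e0 : (stepMatrix (-(t : ℂ)) p).mulVec v 0 = -(((t * geom (-t) (p - 1) : ℝ) : ℂ) * v 0 +
      ((t * geom (-t) (p - 2) : ℝ) : ℂ) * v 1) := by
    simp only [stepMatrix, Matrix.mulVec, dotProduct, Fin.sum_univ_two, Matrix.of_apply,
      Matrix.cons_val_zero, Matrix.cons_val_one, hc]
    ring
  have e1 : (stepMatrix (-(t : ℂ)) p).mulVec v 1 = v 0 + v 1 := by
    simp [stepMatrix, Matrix.mulVec, dotProduct, Fin.sum_univ_two]
  refine max_le ?_ (max_le ?_ ?_)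
  · rw [e0, norm_neg]
    exact norm_combination_le v a0 a1 b0 b1
  · rw [e1]
    exact (le_max_right _ _).trans (le_max_right _ _)
  · have : (stepMatrix (-(t : ℂ)) p).mulVec v 0 + (stepMatrix (-(t : ℂ)) p).mulVec v 1 =
        ((1 - t * geom (-t) (p - 1) : ℝ) : ℂ) * v 0 +
          ((1 - t * geom (-t) (p - 2) : ℝ) : ℂ) * v 1 := by
      rw [e0, e1]; push_cast; ring
    rw [this]
    exact norm_combination_le v (by linarith) (by linarith) (by linarith) (by linarith)

theorem hexNorm_stepProd_le {t : ℝ} (ht : 0 ≤ t) (ht' : t ≤ 1) (l : List ℕ) (v : Fin 2 → ℂ) :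
    hexNorm ((stepProd (-(t : ℂ)) l).mulVec v) ≤ hexNorm v := by
  induction l with
  | nil => simp [stepProd]
  | cons p l ih =>
    rw [stepProd_cons, ← Matrix.mulVec_mulVec]
    exact (hexNorm_stepMatrix_le ht ht' p _).trans ih

theorem hexNorm_smul (c : ℂ) (v : Fin 2 → ℂ) : hexNorm (c • v) = ‖c‖ * hexNorm v := by
  simp only [hexNorm, Pi.smul_apply, smul_eq_mul, ← mul_add, norm_mul,
    mul_max_of_nonneg _ _ (norm_nonneg c)]

theorem hexNorm_pos {v : Fin 2 → ℂ} (hv : v ≠ 0) : 0 < hexNorm v := by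
  by_contra! h
  apply hv
  have h0 : ‖v 0‖ ≤ 0 := (le_max_left _ _).trans h
  have h1 : ‖v 1‖ ≤ 0 := ((le_max_left _ _).trans (le_max_right _ _)).trans h
  ext i
  fin_cases i
  · exact norm_le_zero_iff.1 h0
  · exact norm_le_zero_iff.1 h1

theorem spectralRadius_normalMatrix_le {t : ℝ} (ht : 0 ≤ t) (ht' : t ≤ 1) :
    (spectralRadius ℂ (normalMatrix k l (-(t : ℂ)))).toReal ≤ t ^ (3 * k - l.length) := by
  refine ENNReal.toReal_le_of_le_ofReal (by positivity) (iSup₂_le fun z hz => ?_)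
  rw [← ENNReal.ofReal_coe_nnreal, coe_nnnorm]
  refine ENNReal.ofReal_le_ofReal ?_
  rw [spectrum.mem_iff, Matrix.isUnit_iff_isUnit_det, isUnit_iff_ne_zero, not_not,
    ← Matrix.exists_mulVec_eq_zero_iff] at hz
  obtain ⟨v, hv, hvz⟩ := hz
  rw [Matrix.sub_mulVec, sub_eq_zero, Algebra.algebraMap_eq_smul_one, Matrix.smul_mulVec,
    Matrix.one_mulVec, normalMatrix, Matrix.smul_mulVec] at hvz
  have h := congrArg hexNorm hvz
  rw [hexNorm_smul, hexNorm_smul, norm_pow, norm_neg, Complex.norm_of_nonneg ht] at h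
  have h' := mul_le_mul_of_nonneg_left (hexNorm_stepProd_le ht ht' l v)
    (pow_nonneg ht (3 * k - l.length))
  rw [← h] at h'
  exact le_of_mul_le_mul_right h' (hexNorm_pos hv)

end

/-! ### The value at one -/

/-- Three vectors that are permuted by the Burau matrices at `t = 1`. -/
def vertex : Fin 3 → Fin 2 → ℂ := ![![1, 0], ![-1, 1], ![0, -1]]

/-- The inverse permutation appears because row vectors are acted on from the right. -/
theorem vertex_vecMul_burauHom {w : Braid3} (hw : IsPositive w) (i : Fin 3) :
    Matrix.vecMul (vertex i) (burauHom 1 w) = vertex ((strandPerm w)⁻¹ i) := by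
  induction hw using Submonoid.closure_induction generalizing i with
  | mem x hx =>
    obtain ⟨m, rfl⟩ := hx
    fin_cases m
    · have h : (strandPerm (σ 0))⁻¹ = Equiv.swap 0 1 := by
        simp only [strandPerm, σ, PresentedGroup.toGroup.of]
        rfl
      simp only [Fin.zero_eta, burauHom_sigma_zero, h]
      have h2 : Equiv.swap (0 : Fin 3) 1 2 = 2 := by decide
      fin_cases i <;> ext j <;> fin_cases j <;>
        simp [vertex, h2, Matrix.vecMul, dotProduct, Fin.sum_univ_two]
    · have h : (strandPerm (σ 1))⁻¹ = Equiv.swap 1 2 := by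
        simp only [strandPerm, σ, PresentedGroup.toGroup.of]
        rfl
      simp only [Fin.mk_one, burauHom_sigma_one, h]
      have h2 : Equiv.swap (1 : Fin 3) 2 0 = 0 := by decide
      fin_cases i <;> ext j <;> fin_cases j <;>
        simp [vertex, h2, Matrix.vecMul, dotProduct, Fin.sum_univ_two]
  | one => simp
  | mul x y _ _ hx hy =>
    rw [map_mul, ← Matrix.vecMul_vecMul, hx, hy, map_mul, mul_inv_rev, Equiv.Perm.mul_apply]

theorem rho_one {w : Braid3} (hw : IsPositive w) (h : strandPerm w ^ 3 = 1) : rho w 1 = 1 := by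
  have hcube : burauHom 1 w ^ 3 = 1 := by
    have hv : ∀ i, Matrix.vecMul (vertex i) (burauHom 1 w ^ 3) = vertex i := by
      intro i
      rw [← map_pow, vertex_vecMul_burauHom (pow_mem hw 3), map_pow, h]
      simp
    have h0 := hv 0
    have h1 := hv 1
    generalize burauHom 1 w ^ 3 = M at *
    have a0 := congrFun h0 0
    have a1 := congrFun h0 1
    have b0 := congrFun h1 0
    have b1 := congrFun h1 1
    simp [vertex, Matrix.vecMul, dotProduct, Fin.sum_univ_two] at a0 a1 b0 b1
    ext i j
    fin_cases i <;> fin_cases j <;> simp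
    · exact a0
    · exact a1
    · linear_combination b0 + a0
    · linear_combination b1 + a1
  have hB : burauAt 1 w = burauHom 1 w := burauAt_eq_burauHom hw 1
  have hnorm : ∀ z ∈ spectrum ℂ (burauHom 1 w), (‖z‖₊ : ENNReal) = 1 := by
    intro z hz
    have hz3 := spectrum.pow_mem_pow (burauHom 1 w) 3 hz
    rw [hcube, spectrum.one_eq, Set.mem_singleton_iff] at hz3
    have : ‖z‖ ^ 3 = 1 := by rw [← norm_pow, hz3, norm_one]
    rw [← ENNReal.ofReal_coe_nnreal, coe_nnnorm,
      (pow_eq_one_iff_of_nonneg (norm_nonneg z) three_ne_zero).1 this, ENNReal.ofReal_one]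
  obtain ⟨z, hz⟩ := spectrum.nonempty_of_isAlgClosed_of_finiteDimensional ℂ (burauHom 1 w)
  have : spectralRadius ℂ (burauHom 1 w) = 1 := by
    apply le_antisymm
    · exact iSup₂_le fun z hz => (hnorm z hz).le
    · rw [← hnorm z hz]
      exact le_iSup₂ (f := fun (z : ℂ) (_ : z ∈ spectrum ℂ (burauHom 1 w)) => (‖z‖₊ : ENNReal)) z hz
  rw [rho, hB, this, ENNReal.toReal_one]

theorem normalMatrix_map_ofReal (k : ℕ) (l : List ℕ) (s : ℝ) :
    (normalMatrix k l s).map Complex.ofReal = normalMatrix k l (s : ℂ) := by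
  have h : (stepProd s l).map Complex.ofReal = stepProd (s : ℂ) l := by
    induction l with
    | nil => ext i j; fin_cases i <;> fin_cases j <;> simp [stepProd]
    | cons p l ih =>
      have := Matrix.map_mul (f := Complex.ofRealHom) (L := stepMatrix s p) (M := stepProd s l)
      rw [stepProd_cons, stepProd_cons, ← ih]
      refine this.trans ?_
      congr 1
      ext i j
      fin_cases i <;> fin_cases j <;> simp [stepMatrix, geom]
  ext i j
  have := congrFun (congrFun h i) j
  rw [Matrix.map_apply] at this
  simp [normalMatrix, this]

end ThreeBraid

end

theorem mainTheorem6 (w : ThreeBraid.Braid3) (hpos : ThreeBraid.IsPositive w)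
    (hpA : ThreeBraid.IsPseudoAnosov w) (hknot : ThreeBraid.ClosureIsKnot w) :
    (∃ t₀ ∈ Set.Ioc (-1 : ℝ) ((√5 - 3) / 2),
      {t : ℝ | t ∈ Set.Icc (-1 : ℝ) 1 ∧ ThreeBraid.rho w (t : ℂ) = 1} = {t₀, 1}) ∧
    StrictAntiOn (fun t : ℝ => ThreeBraid.rho w (t : ℂ)) (Set.Icc (-1) 0) ∧
    AnalyticOnNhd ℝ (fun t : ℝ => ThreeBraid.rho w (t : ℂ)) (Set.Ico (-1) 0) := by
  open ThreeBraid in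
  obtain ⟨hperm, hperm3⟩ := strandPerm_of_closureIsKnot hknot
  obtain ⟨k₀, l₀, hl₀, hw₀⟩ := exists_blockProd_of_isPositive hpos
  obtain ⟨j, hj⟩ | ⟨k, l, hk, hnil, hl, hw⟩ :=
    normalForm_of_length _ l₀ k₀ w rfl hl₀ (hw₀ ▸ IsConj.refl _) hperm
  · exact absurd (isPeriodic_of_cube hj) hpA.1
  have h3 := exists_three_le hl hw hperm
  have hk' : l.length < 3 * k := by
    have := List.length_pos_iff.2 hnil
    omega
  have hrho : ∀ t : ℝ, t ≤ 0 → rho w (t : ℂ) = perron (normalMatrix k l (-t)) := by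
    intro t ht
    rw [rho_eq hpos hl hk hw, ← spectralRadius_eq_perron (normalMatrix_nonneg (neg_nonneg.2 ht)),
      normalMatrix_map_ofReal, Complex.ofReal_neg]
  have hanti : StrictAntiOn (fun t : ℝ => rho w (t : ℂ)) (Set.Icc (-1) 0) := by
    intro t ht t' ht' h
    simp only [hrho t ht.2, hrho t' ht'.2]
    exact perron_normalMatrix_strictMonoOn hk' hl h3 (neg_nonneg.2 ht'.2) (neg_nonneg.2 ht.2)
      (neg_lt_neg h)
  have han : AnalyticOnNhd ℝ (fun t : ℝ => rho w (t : ℂ)) (Set.Ico (-1) 0) := by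
    intro t ht
    have h := (analyticAt_perron (k := k) (neg_pos.2 ht.2) hl h3).comp (f := fun t : ℝ => -t)
      (analyticAt_id.neg)
    refine h.congr ?_
    filter_upwards [eventually_lt_nhds ht.2] with u hu
    exact (hrho u hu.le).symm
  refine ⟨?_, hanti, han⟩
  have h5 : √5 ^ 2 = 5 := Real.sq_sqrt (by norm_num)
  have h5l : 2 < √5 := Real.lt_sqrt_of_sq_lt (by norm_num)
  have h5u : √5 < 3 := (Real.sqrt_lt' (by norm_num)).2 (by norm_num)
  set τ : ℝ := (√5 - 3) / 2 with hτ
  have hτ1 : -1 < τ := by rw [hτ]; linarith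
  have hτ0 : τ < 0 := by rw [hτ]; linarith
  have hleft : 1 < rho w ((-1 : ℝ) : ℂ) := by
    rw [hrho (-1) (by norm_num), neg_neg]
    exact one_lt_perron_normalMatrix_one hl h3
  have hright : rho w (τ : ℂ) ≤ 1 := by
    rw [hrho τ hτ0.le]
    -- Here q = (√5 - 1)/2 is the positive root of q² + q = 1.
    have : -τ = ((√5 - 1) / 2) ^ 2 := by rw [hτ]; linarith
    rw [this]
    exact perron_normalMatrix_le_one (by linarith) (by linarith) hk
  have hcont : ContinuousOn (fun t : ℝ => rho w (t : ℂ)) (Set.Icc (-1) τ) := fun t ht =>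
    (han t ⟨ht.1, ht.2.trans_lt hτ0⟩).continuousAt.continuousWithinAt
  obtain ⟨t₀, ht₀, ht₀'⟩ := intermediate_value_Icc' hτ1.le hcont ⟨hright, hleft.le⟩
  have hne : t₀ ≠ -1 := by
    rintro rfl
    exact hleft.ne' ht₀'
  refine ⟨t₀, ⟨lt_of_le_of_ne ht₀.1 hne.symm, ht₀.2⟩, ?_⟩
  ext t
  constructor
  · rintro ⟨ht, ht1⟩
    rcases le_total t 0 with h0 | h0
    · exact Or.inl (hanti.injOn ⟨ht.1, h0⟩ ⟨ht₀.1, ht₀.2.trans hτ0.le⟩ (ht1.trans ht₀'.symm))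
    · refine Or.inr (le_antisymm ht.2 ?_)
      by_contra! h1
      -- On [0, 1) this bound has a positive exponent and is therefore below 1, which excludes
      -- further solutions.
      have hle : rho w (t : ℂ) ≤ t ^ (3 * k - l.length) := by
        rw [rho_eq hpos hl hk hw]
        exact spectralRadius_normalMatrix_le h0 ht.2
      have := pow_lt_one₀ h0 h1 (show 3 * k - l.length ≠ 0 by omega)
      linarith
  · rintro (rfl | rfl)
    · exact ⟨⟨ht₀.1, by linarith [ht₀.2]⟩, ht₀'⟩
    · exact ⟨⟨by norm_num, le_rfl⟩, by rw [Complex.ofReal_one]; exact rho_one hpos hperm3⟩
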